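/- For real parameters $a>0$, $b>0$ let $E_{a,b}(z)=\sum_{n\ge 0} z^n/\Gamma(an+b)$ and $E_a=E_{a,1}$ be the Mittag-Leffler functions, and for $0<\gamma<1$ let $$M_\gamma(z)=\sum_{n\ge 0}\frac{(-z)^n}{n!\,\Gamma(1-\gamma-\gamma n)},\qquad N_\gamma(z)=\sum_{n\ge 0}\frac{(-z)^n}{n!\,\Gamma(2-\gamma-\gamma n)}$$ (special cases $M_\gamma(z)=W_{-\gamma,1-\gamma}(-z)$, $N_\gamma(z)=W_{-\gamma,2-\gamma}(-z)$ of the Wright function $W_{\lambda,\mu}(z)=\sum_{n\ge0} z^n/(n!\,\Gamma(\lambda n+\mu))$, where $1/\Gamma=0$ at the poles of $\Gamma$). Let $G_{\beta,\alpha}(t,\cdot)$ and $H_{\beta,\alpha}(t,\cdot)$ be the first and second fundamental solutions of the Cauchy problem for $\mathrm{D}^\beta u=-(-\mathrm d^2/\mathrm dx^2)^{\alpha/2}u$ on the real line, that is, the inverse Fourier transforms $g\mapsto\frac1{2\pi}\int_{-\infty}^\infty e^{ikx}g(k)\,dk$ of $E_\beta(-|k|^\alpha t^\beta)$ and $t\,E_{\beta,2}(-|k|^\alpha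 t^\beta)$, respectively. Let $\alpha,\beta>0$ and $\gamma=\beta/\alpha<1$. (i) For every $\kappa\ge 0$ $$E_\beta(-\kappa^\alpha)=\int_0^\infty M_\gamma(\xi)\,E_\alpha\bigl(-(\kappa\xi)^\alpha\bigr)\,d\xi,\qquad E_{\beta,2}(-\kappa^\alpha)=\int_0^\infty N_\gamma(\xi)\,E_\alpha\bigl(-(\kappa\xi)^\alpha\bigr)\,d\xi,$$ and both integrals converge absolutely. (ii) If $\alpha\le 2$, then the functions $E_\alpha(-|k|^\alpha)$, $E_\beta(-|k|^\alpha)$ and $E_{\beta,2}(-|k|^\alpha)$ of $k\in\mathbb R$ are bounded, and, for the inverse Fourier transforms in the sense of tempered distributions, $$G_{\beta,\alpha}(1,x)=\int_0^\infty M_\gamma(\xi)\,G_{\alpha,\alpha}(1,x/\xi)\,\frac{d\xi}{\xi},\qquad H_{\beta,\alpha}(1,x)=\int_0^\infty N_\gamma(\xi)\,G_{\alpha,\alpha}(1,x/\xi)\,\frac{d\xi}{\xi},$$ where the integrals converge absolutely after pairing with any Schwartz function. (iii) If $\alpha<2$, then for every real $x\neq 0$ the inverse Fourier integrals defining $G_{\alpha,\alpha}(1,x)$,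 $G_{\beta,\alpha}(1,x)$ and $H_{\beta,\alpha}(1,x)$ converge as $\lim_{R\to\infty}\frac1{2\pi}\int_{-R}^R$, and with these values the two formulas in (ii) hold pointwise at $x$, with absolutely convergent integrals over $\xi$. -/

import Mathlib

open MeasureTheory Set Filter Topology
open scoped SchwartzMap FourierTransform ENNReal

noncomputable section

namespace FracWave

/-- The two-parameter Mittag-Leffler function `E_{a,b}(z) = ∑ zⁿ / Γ(a n + b)`. -/
def mittagLeffler (a b : ℝ) (z : ℂ) : ℂ :=
  ∑' n : ℕ, z ^ n / Complex.Gamma ((a * n + b : ℝ) : ℂ)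

/-- The Wright function `W_{l,m}(z) = ∑ zⁿ / (n! Γ(l n + m))`, `l > -1`. At the poles of `Γ` Mathlib
has `Γ = 0` and `x / 0 = 0`, so that the entire function `1 / Γ` has its correct value `0` there. -/
def wright (l : ℝ) (m z : ℂ) : ℂ :=
  ∑' n : ℕ, z ^ n / ((n.factorial : ℂ) * Complex.Gamma ((l : ℂ) * n + m))

/-- `M_γ(z) = W_{-γ,1-γ}(-z)`. -/
def wrightM (γ : ℝ) (z : ℂ) : ℂ := wright (-γ) (1 - γ) (-z)

/-- `N_γ(z) = W_{-γ,2-γ}(-z)`. -/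
def wrightN (γ : ℝ) (z : ℂ) : ℂ := wright (-γ) (2 - γ) (-z)

/-- The spatial Fourier transform `E_β(-|k|^α t^β)` of the first fundamental solution
`G_{β,α}(t, ·)` of `D^β u = -(-d²/dx²)^{α/2} u` on the real line (Caputo derivative in time). -/
def symbolG (β α t k : ℝ) : ℂ := mittagLeffler β 1 (-((|k| ^ α * t ^ β : ℝ) : ℂ))

/-- The spatial Fourier transform `t E_{β,2}(-|k|^α t^β)` of the second fundamental solution
`H_{β,α}(t, ·)` of the same equation. -/
def symbolH (β α t k : ℝ) : ℂ := t * mittagLeffler β 2 (-((|k| ^ α * t ^ β : ℝ) : ℂ))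

/-- Laplace transform of `t^(m-1) E_{b,m}(-c t^b)`. -/
theorem laplace_mittagLeffler {b m c p : ℝ} (hb : 0 < b) (hm : 0 < m) (hc : 0 ≤ c) (hp : 0 < p)
    (hcp : c < p ^ b) :
    ∫ t in Ioi (0 : ℝ), (Real.exp (-(p * t)) : ℂ) *
        (((t ^ (m - 1) : ℝ) : ℂ) * mittagLeffler b m (-((c * t ^ b : ℝ) : ℂ))) =
      ((p ^ (b - m) / (p ^ b + c) : ℝ) : ℂ) := by
  set F : ℕ → ℝ → ℝ := fun n t =>
    ((-c) ^ n / Real.Gamma (b * n + m)) * (t ^ (b * n + m - 1) * Real.exp (-(p * t))) with hF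
  have ha : ∀ n : ℕ, 0 < b * n + m := fun n => by positivity
  have hG : ∀ n : ℕ, 0 < Real.Gamma (b * n + m) := fun n => Real.Gamma_pos_of_pos (ha n)
  have hI : ∀ n : ℕ, ∫ t in Ioi (0 : ℝ), t ^ (b * n + m - 1) * Real.exp (-(p * t)) =
      (1 / p) ^ (b * n + m) * Real.Gamma (b * n + m) := fun n =>
    Real.integral_rpow_mul_exp_neg_mul_Ioi (ha n) hp
  have hInt : ∀ n : ℕ, Integrable (fun t : ℝ => t ^ (b * n + m - 1) * Real.exp (-(p * t)))
      (volume.restrict (Ioi 0)) := fun n => by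
    by_contra h
    have h0 := integral_undef h
    rw [hI n] at h0
    have : 0 < (1 / p) ^ (b * n + m) * Real.Gamma (b * n + m) :=
      mul_pos (Real.rpow_pos_of_pos (by positivity) _) (hG n)
    linarith
  have hpow : ∀ n : ℕ, (1 / p) ^ (b * n + m) = p ^ (-m) * (1 / p ^ b) ^ n := fun n => by
    rw [one_div, Real.inv_rpow hp.le, Real.rpow_add hp, Real.rpow_mul hp.le, Real.rpow_natCast,
      Real.rpow_neg hp.le, one_div, inv_pow, mul_inv]
    ring
  have hpb : 0 < p ^ b := Real.rpow_pos_of_pos hp b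
  have hFI : ∀ n, ∫ t in Ioi (0 : ℝ), F n t = p ^ (-m) * (-c / p ^ b) ^ n := fun n => by
    simp only [hF]
    rw [integral_const_mul, hI n, hpow n, div_pow, div_pow, one_pow]
    have := (hG n).ne'
    field_simp
  have hnorm : ∀ n, ∫ t in Ioi (0 : ℝ), ‖F n t‖ = p ^ (-m) * (c / p ^ b) ^ n := fun n => by
    have : ∀ t ∈ Ioi (0 : ℝ), ‖F n t‖ =
        (c ^ n / Real.Gamma (b * n + m)) * (t ^ (b * n + m - 1) * Real.exp (-(p * t))) := by
      intro t ht
      have h1 : 0 ≤ t ^ (b * n + m - 1) := Real.rpow_nonneg (le_of_lt ht) _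
      simp only [hF]
      rw [norm_mul, norm_div, norm_pow, norm_neg, Real.norm_of_nonneg hc,
        Real.norm_of_nonneg (hG n).le, Real.norm_of_nonneg (by positivity)]
    rw [setIntegral_congr_fun measurableSet_Ioi this, integral_const_mul, hI n, hpow n, div_pow,
      div_pow, one_pow]
    have := (hG n).ne'
    field_simp
  have hq : c / p ^ b < 1 := (div_lt_one hpb).2 hcp
  have hq0 : 0 ≤ c / p ^ b := by positivity
  have key : HasSum (fun n => ∫ t in Ioi (0 : ℝ), F n t) (∫ t in Ioi (0 : ℝ), ∑' n, F n t) := by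
    refine hasSum_integral_of_summable_integral_norm (fun n => (hInt n).const_mul _) ?_
    simp only [hnorm]
    exact (summable_geometric_of_lt_one hq0 hq).mul_left _
  have key2 : HasSum (fun n => ∫ t in Ioi (0 : ℝ), F n t)
      (p ^ (-m) * (1 - -c / p ^ b)⁻¹) := by
    simp only [hFI]
    refine (hasSum_geometric_of_abs_lt_one ?_).mul_left _
    rw [neg_div, abs_neg, abs_of_nonneg hq0]
    exact hq
  have hval := key.unique key2
  have hpt : ∀ t ∈ Ioi (0 : ℝ), (Real.exp (-(p * t)) : ℂ) *
      (((t ^ (m - 1) : ℝ) : ℂ) * mittagLeffler b m (-((c * t ^ b : ℝ) : ℂ))) =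
      ((∑' n, F n t : ℝ) : ℂ) := by
    intro t ht
    rw [mittagLeffler, ← tsum_mul_left, ← tsum_mul_left, Complex.ofReal_tsum]
    refine tsum_congr fun n => ?_
    have ht' : (0 : ℝ) < t := ht
    have e : t ^ (b * n + m - 1) = t ^ (m - 1) * (t ^ b) ^ n := by
      rw [← Real.rpow_natCast, ← Real.rpow_mul ht'.le, ← Real.rpow_add ht']
      congr 1
      ring
    rw [Complex.Gamma_ofReal]
    simp only [hF, e]
    push_cast
    rw [show -((c : ℂ) * ((t ^ b : ℝ) : ℂ)) = -(c : ℂ) * ((t ^ b : ℝ) : ℂ) by ring, mul_pow]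
    ring
  rw [setIntegral_congr_fun measurableSet_Ioi hpt, integral_complex_ofReal, hval]
  congr 1
  rw [Real.rpow_sub hp, Real.rpow_neg hp.le]
  have h1 : p ^ b + c ≠ 0 := by positivity
  have h2 : p ^ m ≠ 0 := (Real.rpow_pos_of_pos hp m).ne'
  have h3 : 1 - -c / p ^ b = (p ^ b + c) / p ^ b := by
    field_simp
    ring
  rw [h3, inv_div]
  field_simp

/-- The Laplace-Fourier transform of `G_{β,α}` is `p^{β-1} / (p^β + |k|^α)`. -/
theorem laplace_symbolG {β α p k : ℝ} (hβ : 0 < β) (hp : 0 < p) (hk : |k| ^ α < p ^ β) :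
    ∫ t in Ioi (0 : ℝ), (Real.exp (-(p * t)) : ℂ) * symbolG β α t k =
      ((p ^ (β - 1) / (p ^ β + |k| ^ α) : ℝ) : ℂ) := by
  rw [← laplace_mittagLeffler hβ one_pos (Real.rpow_nonneg (abs_nonneg k) α) hp hk]
  simp [symbolG]

/-- The Laplace-Fourier transform of `H_{β,α}` is `p^{β-2} / (p^β + |k|^α)`. -/
theorem laplace_symbolH {β α p k : ℝ} (hβ : 0 < β) (hp : 0 < p) (hk : |k| ^ α < p ^ β) :
    ∫ t in Ioi (0 : ℝ), (Real.exp (-(p * t)) : ℂ) * symbolH β α t k =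
      ((p ^ (β - 2) / (p ^ β + |k| ^ α) : ℝ) : ℂ) := by
  rw [← laplace_mittagLeffler hβ two_pos (Real.rpow_nonneg (abs_nonneg k) α) hp hk]
  norm_num [symbolH]

/-- `g` is an essentially bounded function of the angular wave number. -/
def BoundedSymbol (g : ℝ → ℂ) : Prop :=
  MemLp (fun ν : ℝ => g (2 * Real.pi * ν)) ∞ volume

open Classical in
/-- The tempered distribution `(1 / 2π) ∫ e^{ikx} g(k) dk` for a bounded symbol `g`. Mathlib's `𝓕⁻`
is `∫ e^{2πiνx} f(ν) dν`, hence the substitution `k = 2πν`. (The value `0` for other `g` is not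
used.) -/
def invFourier (g : ℝ → ℂ) : 𝓢'(ℝ, ℂ) :=
  if h : BoundedSymbol g then 𝓕⁻ (Lp.toTemperedDistribution (MemLp.toLp _ h)) else 0

/-- `invFourier` written out on a test function. -/
theorem invFourier_apply {g : ℝ → ℂ} (h : BoundedSymbol g) (φ : 𝓢(ℝ, ℂ)) :
    invFourier g φ =
      ∫ ν : ℝ, (∫ x : ℝ, Complex.exp (Complex.I * (2 * Real.pi * ν : ℝ) * x) * φ x) *
        g (2 * Real.pi * ν) := by
  rw [invFourier, dif_pos h, TemperedDistribution.fourierInv_apply,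
    Lp.toTemperedDistribution_apply]
  refine integral_congr_ae ?_
  filter_upwards [MemLp.coeFn_toLp h] with ν hν
  rw [hν, smul_eq_mul, SchwartzMap.fourierInv_coe, Real.fourierInv_eq']
  congr 1
  refine integral_congr_ae (Eventually.of_forall fun x => ?_)
  simp only [smul_eq_mul]
  congr 2
  simp
  ring

/-- `G_{β,α}(t, ·)` as a tempered distribution. -/
def distG (β α t : ℝ) : 𝓢'(ℝ, ℂ) := invFourier (symbolG β α t)

/-- `H_{β,α}(t, ·)` as a tempered distribution. -/
def distH (β α t : ℝ) : 𝓢'(ℝ, ℂ) := invFourier (symbolH β α t)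

/-- The test function `x ↦ φ(ξ x)`, `ξ ≠ 0`. -/
def dilate (ξ : ℝ) (φ : 𝓢(ℝ, ℂ)) : 𝓢(ℝ, ℂ) :=
  if h : ξ ≠ 0 then
    SchwartzMap.compCLMOfContinuousLinearEquiv ℂ
      (ContinuousLinearEquiv.unitsEquivAut ℝ (Units.mk0 ξ h)) φ
  else 0

theorem dilate_apply {ξ : ℝ} (h : ξ ≠ 0) (φ : 𝓢(ℝ, ℂ)) (x : ℝ) : dilate ξ φ x = φ (ξ * x) := by
  simp [dilate, h, mul_comm]

/-- The pairing `⟨T(·/ξ), φ⟩ = ξ ⟨T, φ(ξ ·)⟩` for `ξ > 0`. -/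
def rescaledPairing (T : 𝓢'(ℝ, ℂ)) (ξ : ℝ) (φ : 𝓢(ℝ, ℂ)) : ℂ := ξ * T (dilate ξ φ)

/-- `U = ∫_0^∞ m(ξ) T(·/ξ) dξ/ξ` as tempered distributions: the integral converges absolutely after
pairing with any test function. -/
def IsMellinConvolution (m : ℝ → ℂ) (T U : 𝓢'(ℝ, ℂ)) : Prop :=
  ∀ φ : 𝓢(ℝ, ℂ),
    IntegrableOn (fun ξ : ℝ => m ξ * rescaledPairing T ξ φ / ξ) (Ioi 0) ∧
    U φ = ∫ ξ in Ioi (0 : ℝ), m ξ * rescaledPairing T ξ φ / ξ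

/-- The truncated inverse Fourier integral `(1 / 2π) ∫_{-R}^R e^{ikx} g(k) dk`. -/
def truncInvFourier (g : ℝ → ℂ) (x R : ℝ) : ℂ :=
  (2 * Real.pi : ℂ)⁻¹ * ∫ k in (-R)..R, Complex.exp (Complex.I * k * x) * g k

/-- The value at `x` of the inverse Fourier transform of `g`, as an improper integral. -/
def invFourierAt (g : ℝ → ℂ) (x : ℝ) : ℂ := limUnder atTop (truncInvFourier g x)

/-- The improper inverse Fourier integral of `g` converges at `x`. -/
def InvFourierConvergesAt (g : ℝ → ℂ) (x : ℝ) : Prop :=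
  ∃ l : ℂ, Tendsto (truncInvFourier g x) atTop (𝓝 l)

/-- `G_{β,α}(t, x)` as a function of `x ≠ 0`. -/
def funG (β α t x : ℝ) : ℂ := invFourierAt (symbolG β α t) x

/-- `H_{β,α}(t, x)` as a function of `x ≠ 0`. -/
def funH (β α t x : ℝ) : ℂ := invFourierAt (symbolH β α t) x

end FracWave

end

/-! Everything rests on the moments of the Wright function, `∫ W_{-γ,μ}(-ξ) ξ^s dξ =
Γ(s+1)/Γ(μ+γ(s+1))` for `s ≥ 0` (`integral_wright_mul_rpow`). Expand `E_α(-(κξ)^α)` in its power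
series and integrate termwise: the moment with `s = αn` cancels `Γ(αn+1)` and leaves `Γ(βn+μ+γ)`, so
the sum is `E_{β,μ+γ}(-κ^α)`. The values `μ = 1-γ` and `μ = 2-γ` give the identities for `M_γ` and
`N_γ` (`subordination`).

The moments, and a decay in `ξ` faster than every exponential, come from `W_{-γ,μ}(-ξ) = (1/2πi) ∫
e^σ σ^{-μ} exp(-ξ σ^γ) dσ` over a Hankel contour (`wright_eq`). This follows from Hankel's formula
for `1/Γ` (`hankel`) by termwise integration. Since `γ < 1`, the contour can be bent into the left
half-plane while `Re σ^γ` stays positive on it. Moving its apex to the right makes `Re σ^γ` as large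
as desired.

For `α ≤ 2`, `E_α` is bounded on the negative axis, because it is subordinated to `E_2(-x²) = cos x`
when `α < 2`. The distributional formulas are then Fubini's theorem, with the dilation moved onto
the symbol (`isMellinConvolution_invFourier`).

For `α < 2`, the contour formula also gives decay of `E_α(-u)` and its derivative
(`exists_mittagLeffler_decay`). Integration by parts bounds the truncated Fourier integrals of
`E_α(-|k|^α)` at `y` by `D/|y|`, uniformly in the truncation. At `y = x/ξ` the factor `1/ξ` cancels
the growth in `ξ`, so dominated convergence yields the pointwise formulas
(`mellin_convolution_pointwise`). -/

noncomputable section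

namespace FracWave

/-! ### Geometry of the rays of a Hankel contour -/

/-- A unit vector in the open second quadrant. -/
structure IsContourDir (w : ℂ) : Prop where
  norm_eq : ‖w‖ = 1
  re_neg : w.re < 0
  im_pos : 0 < w.im

/-- The ray from `c` in direction `w`, the upper half of a Hankel contour. -/
def ray (c : ℝ) (w : ℂ) (r : ℝ) : ℂ := c + r * w

@[simp] theorem ray_re (c : ℝ) (w : ℂ) (r : ℝ) : (ray c w r).re = c + r * w.re := by
  simp [ray]

@[simp] theorem ray_im (c : ℝ) (w : ℂ) (r : ℝ) : (ray c w r).im = r * w.im := by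
  simp [ray]

@[simp] theorem ray_zero (c : ℝ) (w : ℂ) : ray c w 0 = c := by simp [ray]

theorem continuous_ray (c : ℝ) (w : ℂ) : Continuous (ray c w) := by
  unfold ray; fun_prop

theorem hasDerivAt_ray (c : ℝ) (w : ℂ) (r : ℝ) : HasDerivAt (ray c w) w r := by
  have := ((Complex.ofRealCLM.hasDerivAt (x := r)).mul_const w).const_add (c : ℂ)
  simp only [Complex.ofRealCLM_apply, Complex.ofReal_one, one_mul] at this
  exact this

theorem hasDerivAt_ray_left (c : ℝ) (w : ℂ) (r : ℝ) : HasDerivAt (fun c => ray c w r) 1 c := by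
  have := (Complex.ofRealCLM.hasDerivAt (x := c)).add_const ((r : ℂ) * w)
  simp only [Complex.ofRealCLM_apply, Complex.ofReal_one] at this
  exact this

namespace IsContourDir

variable {w : ℂ} {c r : ℝ}

theorem sq_add_sq (hw : IsContourDir w) : w.re ^ 2 + w.im ^ 2 = 1 := by
  have := Complex.sq_norm w
  rw [hw.norm_eq, Complex.normSq_apply] at this
  nlinarith

theorem ne_zero (hw : IsContourDir w) : w ≠ 0 := fun h => by
  have := hw.im_pos
  simp [h] at this

theorem mem_slitPlane (hw : IsContourDir w) (hc : 0 < c) (hr : 0 ≤ r) :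
    ray c w r ∈ Complex.slitPlane := by
  rw [Complex.mem_slitPlane_iff]
  rcases hr.eq_or_lt with rfl | hr
  · left; simpa using hc
  · right
    simpa using ⟨hr.ne', hw.im_pos.ne'⟩

theorem ray_ne_zero (hw : IsContourDir w) (hc : 0 < c) (hr : 0 ≤ r) : ray c w r ≠ 0 :=
  Complex.slitPlane_ne_zero (hw.mem_slitPlane hc hr)

theorem norm_ray_pos (hw : IsContourDir w) (hc : 0 < c) (hr : 0 ≤ r) : 0 < ‖ray c w r‖ :=
  norm_pos_iff.2 (hw.ray_ne_zero hc hr)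

theorem sq_norm_ray (hw : IsContourDir w) :
    ‖ray c w r‖ ^ 2 = c ^ 2 + 2 * c * r * w.re + r ^ 2 := by
  rw [Complex.sq_norm, Complex.normSq_apply, ray_re, ray_im]
  linear_combination r ^ 2 * hw.sq_add_sq

/-- The distance from the origin to the line carrying the ray: the squares differ by `(c Re w +
r)²`. -/
theorem mul_im_le_norm_ray (hw : IsContourDir w) : c * w.im ≤ ‖ray c w r‖ := by
  refine abs_le_of_sq_le_sq' ?_ (norm_nonneg _) |>.2
  rw [hw.sq_norm_ray]
  nlinarith [hw.sq_add_sq, sq_nonneg (c * w.re + r)]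

theorem mul_im_le_norm_ray' : r * w.im ≤ ‖ray c w r‖ := by
  have := Complex.abs_im_le_norm (ray c w r)
  rw [ray_im] at this
  exact (le_abs_self _).trans this

theorem norm_ray_le (hw : IsContourDir w) (hc : 0 ≤ c) (hr : 0 ≤ r) : ‖ray c w r‖ ≤ c + r := by
  refine (norm_add_le _ _).trans ?_
  simp [hw.norm_eq, abs_of_nonneg hc, abs_of_nonneg hr]

theorem tendsto_norm_ray (hw : IsContourDir w) : Tendsto (fun r => ‖ray c w r‖) atTop atTop :=
  tendsto_atTop_mono (fun _ => mul_im_le_norm_ray') (tendsto_id.atTop_mul_const hw.im_pos)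

theorem arg_ray_nonneg (hw : IsContourDir w) (hr : 0 ≤ r) :
    0 ≤ (ray c w r).arg := by
  rw [Complex.arg_nonneg_iff, ray_im]
  exact mul_nonneg hr hw.im_pos.le

/-- Through `arccos` this becomes `Re w · ‖σ‖ ≤ Re σ` for `σ = c + r w`, which follows from `‖σ‖ ≥ r
- c` and `-1 ≤ Re w < 0`. -/
theorem arg_ray_le (hw : IsContourDir w) (hc : 0 < c) (hr : 0 ≤ r) :
    (ray c w r).arg ≤ w.arg := by
  have h0 := hw.norm_ray_pos hc hr
  rw [Complex.arg_of_im_pos hw.im_pos, Complex.arg_of_im_nonneg_of_ne_zero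
    (by simpa using mul_nonneg hr hw.im_pos.le) (hw.ray_ne_zero hc hr), hw.norm_eq, div_one]
  apply Real.arccos_le_arccos
  rw [le_div_iff₀ h0, ray_re]
  have h1 : r - c ≤ ‖ray c w r‖ := by
    have := norm_sub_norm_le ((r : ℂ) * w) (-(c : ℂ))
    rw [norm_neg, norm_mul, hw.norm_eq, Complex.norm_real, Complex.norm_real,
      Real.norm_of_nonneg hr, Real.norm_of_nonneg hc.le, mul_one] at this
    simpa [ray, add_comm] using this
  have h2 : -1 ≤ w.re := by nlinarith [hw.sq_add_sq, hw.im_pos]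
  nlinarith [hw.re_neg]

theorem continuousOn_cpow_ray (hw : IsContourDir w) (hc : 0 < c) (s : ℂ) :
    ContinuousOn (fun r => ray c w r ^ s) (Ici 0) := fun _ hr =>
  (continuousAt_cpow_const (hw.mem_slitPlane hc hr)).comp_continuousWithinAt
    (continuous_ray c w).continuousAt.continuousWithinAt

end IsContourDir

/-! ### Integrability along the contour and the complex Gamma integral -/

section

/-- Each factor takes half of the rate `ε`; for the second, `X x^γ = o(x)` because `γ < 1`. -/
theorem rpow_mul_exp_rpow_isBigO {γ X ε : ℝ} (hγ : γ < 1) (a : ℝ) (hε : 0 < ε) :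
    (fun x : ℝ => x ^ a * Real.exp (X * x ^ γ)) =O[atTop] fun x => Real.exp (ε * x) := by
  have h1 : (fun x : ℝ => x ^ a) =O[atTop] fun x => Real.exp (ε / 2 * x) :=
    (isLittleO_rpow_exp_pos_mul_atTop a (half_pos hε)).isBigO
  have h2 : (fun x : ℝ => Real.exp (X * x ^ γ)) =O[atTop] fun x => Real.exp (ε / 2 * x) := by
    have h3 : (fun x : ℝ => X * x ^ γ) =o[atTop] fun x : ℝ => x := by
      refine Asymptotics.IsLittleO.const_mul_left ?_ X
      refine (Asymptotics.isLittleO_iff_tendsto' ?_).2 ?_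
      · filter_upwards [eventually_gt_atTop 0] with x hx h using absurd h hx.ne'
      · refine (tendsto_rpow_neg_atTop (sub_pos.2 hγ)).congr' ?_
        filter_upwards [eventually_gt_atTop 0] with x hx
        rw [neg_sub, Real.rpow_sub_one hx.ne']
    refine Asymptotics.IsBigO.of_bound 1 ?_
    filter_upwards [h3.bound (half_pos hε), eventually_ge_atTop 0] with x hx hx0
    rw [Real.norm_of_nonneg hx0] at hx
    rw [one_mul, Real.norm_of_nonneg (Real.exp_pos _).le, Real.norm_of_nonneg (Real.exp_pos _).le]
    exact Real.exp_le_exp.2 ((Real.le_norm_self _).trans hx)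
  refine (h1.mul h2).congr_right fun x => ?_
  rw [← Real.exp_add]
  congr 1
  ring

variable {w : ℂ} {c : ℝ}

/-- Integrability along the contour of the majorants used below. -/
theorem IsContourDir.integrableOn_majorant (hw : IsContourDir w) (hc : 0 < c) {γ : ℝ}
    (hγ : γ < 1) (a X : ℝ) :
    IntegrableOn (fun r => Real.exp (ray c w r).re *
      (‖ray c w r‖ ^ a * Real.exp (X * ‖ray c w r‖ ^ γ))) (Ioi 0) := by
  have hcn : ∀ s : ℝ, ContinuousOn (fun r => ‖ray c w r‖ ^ s) (Ici 0) := fun s =>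
    (continuous_ray c w).norm.continuousOn.rpow_const fun r hr =>
      Or.inl (hw.norm_ray_pos hc hr).ne'
  have hk : 0 < -w.re := neg_pos.2 hw.re_neg
  refine integrable_of_isBigO_exp_neg (half_pos hk) ?_ ?_
  · refine ContinuousOn.mul ?_ ((hcn a).mul ?_)
    · exact (Real.continuous_exp.comp (Complex.continuous_re.comp
        (continuous_ray c w))).continuousOn
    · exact Real.continuous_exp.comp_continuousOn ((hcn γ).const_smul X)
  · have h1 := (rpow_mul_exp_rpow_isBigO (X := X) hγ a (half_pos hk)).comp_tendsto
      (hw.tendsto_norm_ray (c := c))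
    have h2 : (fun r => Real.exp (-w.re / 2 * ‖ray c w r‖)) =O[atTop]
        fun r => Real.exp (-w.re / 2 * r) := by
      refine Asymptotics.IsBigO.of_bound (Real.exp (-w.re / 2 * c)) ?_
      filter_upwards [eventually_ge_atTop 0] with r hr
      rw [Real.norm_of_nonneg (Real.exp_pos _).le, Real.norm_of_nonneg (Real.exp_pos _).le,
        ← Real.exp_add]
      apply Real.exp_le_exp.2
      rw [← mul_add]
      exact mul_le_mul_of_nonneg_left (hw.norm_ray_le hc.le hr) (half_pos hk).le
    have h3 : (fun r => Real.exp (ray c w r).re) =O[atTop] fun r => Real.exp (r * w.re) := by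
      refine Asymptotics.IsBigO.of_bound (Real.exp c) (Eventually.of_forall fun r => ?_)
      rw [Real.norm_of_nonneg (Real.exp_pos _).le, Real.norm_of_nonneg (Real.exp_pos _).le,
        ← Real.exp_add, ray_re]
    refine (h3.mul (h1.trans h2)).congr_right fun r => ?_
    rw [← Real.exp_add]
    congr 1
    ring

theorem IsContourDir.integrableOn_exp_mul_rpow (hw : IsContourDir w) (hc : 0 < c) (a : ℝ) :
    IntegrableOn (fun r => Real.exp (ray c w r).re * ‖ray c w r‖ ^ a) (Ioi 0) := by
  simpa using hw.integrableOn_majorant hc zero_lt_one a 0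

theorem norm_exp_mul_cpow_ray (r a : ℝ) :
    ‖Complex.exp (ray c w r) * ray c w r ^ (a : ℂ)‖ =
      Real.exp (ray c w r).re * ‖ray c w r‖ ^ a := by
  rw [norm_mul, Complex.norm_exp, Complex.norm_cpow_real]

theorem IsContourDir.continuousOn_exp_mul_cpow (hw : IsContourDir w) (hc : 0 < c) (s : ℂ) :
    ContinuousOn (fun r => Complex.exp (ray c w r) * ray c w r ^ s) (Ici 0) :=
  (Complex.continuous_exp.comp (continuous_ray c w)).continuousOn.mul
    (hw.continuousOn_cpow_ray hc s)

theorem IsContourDir.integrableOn_exp_mul_cpow (hw : IsContourDir w) (hc : 0 < c) (a : ℝ) :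
    IntegrableOn (fun r => Complex.exp (ray c w r) * ray c w r ^ (a : ℂ)) (Ioi 0) := by
  refine (hw.integrableOn_exp_mul_rpow hc a).mono'
    (((hw.continuousOn_exp_mul_cpow hc a).mono Ioi_subset_Ici_self).aestronglyMeasurable
      measurableSet_Ioi) (Eventually.of_forall fun r => (norm_exp_mul_cpow_ray r a).le)

/-- `∫₀^∞ t^(a-1) e^(-ζ t) dt = Γ(a) ζ^(-a)` for `Re ζ > 0`. -/
theorem integral_rpow_mul_cexp_neg_mul_Ioi {a : ℝ} (ha : 0 < a) {ζ : ℂ} (hζ : 0 < ζ.re) :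
    ∫ t in Ioi (0 : ℝ), ((t ^ (a - 1) : ℝ) : ℂ) * Complex.exp (-(ζ * t)) =
      Complex.Gamma a * ζ ^ (-a : ℂ) := by
  -- With `J' = -J(a+1, ·)` and, by parts, `z J(a+1, z) = a J(a, z)`, the function `z^a J(a, z)` has
  -- derivative zero on the right half-plane. Its value at `1` is `Γ(a)`.
  set J : ℝ → ℂ → ℂ := fun b z => ∫ t in Ioi (0 : ℝ), ((t ^ (b - 1) : ℝ) : ℂ) *
    Complex.exp (-(z * t)) with hJ
  have hnorm : ∀ (b : ℝ) (z : ℂ) {t : ℝ}, t ∈ Ioi (0 : ℝ) →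
      ‖((t ^ (b - 1) : ℝ) : ℂ) * Complex.exp (-(z * t))‖ =
        t ^ (b - 1) * Real.exp (-(z.re * t)) := by
    intro b z t ht
    rw [norm_mul, Complex.norm_exp, Complex.norm_real,
      Real.norm_of_nonneg (Real.rpow_nonneg (le_of_lt ht) _)]
    simp
  have hreal : ∀ {b x : ℝ}, 0 < b → 0 < x →
      IntegrableOn (fun t : ℝ => t ^ (b - 1) * Real.exp (-(x * t))) (Ioi 0) := by
    intro b x hb hx
    -- A non-integrable function has integral `0` by convention, whereas the known value is
    -- positive.
    by_contra h
    have h0 := integral_undef h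
    rw [Real.integral_rpow_mul_exp_neg_mul_Ioi hb hx] at h0
    have := mul_pos (Real.rpow_pos_of_pos (one_div_pos.2 hx) b) (Real.Gamma_pos_of_pos hb)
    exact this.ne' h0
  have hmeas : ∀ (b : ℝ) (z : ℂ), AEStronglyMeasurable
      (fun t : ℝ => ((t ^ (b - 1) : ℝ) : ℂ) * Complex.exp (-(z * t)))
      (volume.restrict (Ioi 0)) := by
    intro b z
    exact Measurable.aestronglyMeasurable (by fun_prop)
  have hint : ∀ {b : ℝ} {z : ℂ}, 0 < b → 0 < z.re → IntegrableOn
      (fun t : ℝ => ((t ^ (b - 1) : ℝ) : ℂ) * Complex.exp (-(z * t))) (Ioi 0) := by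
    intro b z hb hz
    refine (hreal hb hz).mono' (hmeas b z) ?_
    filter_upwards [ae_restrict_mem measurableSet_Ioi] with t ht using (hnorm b z ht).le
  have hderiv : ∀ z : ℂ, 0 < z.re → HasDerivAt (J a) (-J (a + 1) z) z := by
    intro z hz
    have hs : {y : ℂ | z.re / 2 < y.re} ∈ 𝓝 z :=
      (isOpen_lt continuous_const Complex.continuous_re).mem_nhds (by simp; linarith)
    have := (hasDerivAt_integral_of_dominated_loc_of_deriv_le (μ := volume.restrict (Ioi 0))
      (F := fun (z : ℂ) (t : ℝ) => ((t ^ (a - 1) : ℝ) : ℂ) * Complex.exp (-(z * t)))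
      (F' := fun (z : ℂ) (t : ℝ) => -(((t ^ (a + 1 - 1) : ℝ) : ℂ) * Complex.exp (-(z * t))))
      (bound := fun t => t ^ (a + 1 - 1) * Real.exp (-(z.re / 2 * t)))
      (x₀ := z) hs (Eventually.of_forall (hmeas a)) (hint ha hz) (hmeas (a + 1) z).neg ?_
      (hreal (by linarith) (half_pos hz)) ?_).2
    · rwa [integral_neg] at this
    · filter_upwards [ae_restrict_mem measurableSet_Ioi] with t ht y hy
      rw [norm_neg, hnorm _ _ ht]
      have h1 : (0 : ℝ) < t := ht
      have h2 : z.re / 2 < y.re := hy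
      gcongr
    · filter_upwards [ae_restrict_mem measurableSet_Ioi] with t ht y hy
      have h1 : (0 : ℝ) < t := ht
      have h3 : HasDerivAt (fun y : ℂ => -(y * (t : ℂ))) (-(t : ℂ)) y := by
        simpa only [id, one_mul] using! ((hasDerivAt_id y).mul_const (t : ℂ)).neg
      convert! h3.cexp.const_mul ((t ^ (a - 1) : ℝ) : ℂ) using 1
      rw [show a + 1 - 1 = (a - 1) + 1 by ring, Real.rpow_add_one h1.ne']
      push_cast
      ring
  have hparts : ∀ z : ℂ, 0 < z.re → z * J (a + 1) z = a * J a z := by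
    intro z hz
    have h1 : ∀ t ∈ Ioi (0 : ℝ), HasDerivAt
        (fun t : ℝ => ((t ^ a : ℝ) : ℂ) * Complex.exp (-(z * t)))
        (a * (((t ^ (a - 1) : ℝ) : ℂ) * Complex.exp (-(z * t))) -
          z * (((t ^ (a + 1 - 1) : ℝ) : ℂ) * Complex.exp (-(z * t)))) t := by
      intro t ht
      have e1 := (Real.hasDerivAt_rpow_const (p := a) (Or.inl (ne_of_gt ht))).ofReal_comp
      have e2 : HasDerivAt (fun t : ℝ => -(z * (t : ℂ))) (-z) t := by
        simpa only [Complex.ofRealCLM_apply, Complex.ofReal_one, mul_one] using!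
          ((Complex.ofRealCLM.hasDerivAt (x := t)).const_mul z).neg
      convert! e1.mul e2.cexp using 1
      rw [add_sub_cancel_right]
      push_cast
      ring
    have h2 := integral_Ioi_of_hasDerivAt_of_tendsto (m := 0) ?_ h1
      (((hint ha hz).const_mul _).sub ((hint (by linarith) hz).const_mul _)) ?_
    · rw [integral_sub ((hint ha hz).const_mul _) ((hint (by linarith) hz).const_mul _),
        integral_const_mul, integral_const_mul] at h2
      simp only [Real.zero_rpow ha.ne', Complex.ofReal_zero, zero_mul, sub_zero] at h2
      exact (sub_eq_zero.1 h2).symm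
    · refine ContinuousAt.continuousWithinAt (ContinuousAt.mul ?_ (by fun_prop))
      exact Complex.continuous_ofReal.continuousAt.comp
        (Real.continuousAt_rpow_const _ _ (Or.inr ha.le))
    · rw [tendsto_zero_iff_norm_tendsto_zero]
      have := tendsto_rpow_mul_exp_neg_mul_atTop_nhds_zero a z.re hz
      refine this.congr' ?_
      filter_upwards [eventually_gt_atTop 0] with t ht
      have := hnorm (a + 1) z (t := t) ht
      rw [add_sub_cancel_right] at this
      rw [this, neg_mul]
  have hslit : ∀ z : ℂ, 0 < z.re → z ∈ Complex.slitPlane := fun z hz => Or.inl hz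
  have hd0 : ∀ z : ℂ, 0 < z.re → HasDerivAt (fun z => z ^ (a : ℂ) * J a z) 0 z := by
    intro z hz
    have hz0 : z ≠ 0 := Complex.slitPlane_ne_zero (hslit z hz)
    convert! ((hasDerivAt_id z).cpow_const (c := (a : ℂ)) (hslit z hz)).mul (hderiv z hz) using 1
    have := hparts z hz
    simp only [id]
    rw [Complex.cpow_sub _ _ hz0, Complex.cpow_one]
    field_simp
    linear_combination (z ^ (a : ℂ)) * this
  have hconst : ζ ^ (a : ℂ) * J a ζ = (1 : ℂ) ^ (a : ℂ) * J a 1 := by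
    have hconv : Convex ℝ {z : ℂ | 0 < z.re} := convex_halfSpace_re_gt 0
    have hopen : IsOpen {z : ℂ | 0 < z.re} := isOpen_lt continuous_const Complex.continuous_re
    refine hopen.is_const_of_deriv_eq_zero hconv.isPreconnected
      (fun z hz => (hd0 z hz).differentiableAt.differentiableWithinAt)
      (fun z hz => (hd0 z hz).deriv) hζ (by simp)
  have h1 : J a 1 = Complex.Gamma a := by
    have := Complex.integral_cpow_mul_exp_neg_mul_Ioi (a := a) (r := 1) (by simpa) one_pos
    simp only [Complex.ofReal_one, one_mul, div_one, Complex.one_cpow] at this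
    rw [← this]
    refine setIntegral_congr_fun measurableSet_Ioi fun t ht => ?_
    simp only [one_mul]
    rw [Complex.ofReal_cpow (le_of_lt ht)]
    push_cast
    rfl
  have hζ0 : ζ ^ (a : ℂ) ≠ 0 := by
    rw [Ne, Complex.cpow_eq_zero_iff]
    exact fun h => Complex.slitPlane_ne_zero (hslit ζ hζ) h.1
  rw [Complex.one_cpow, one_mul, h1] at hconst
  rw [Complex.cpow_neg, ← hconst]
  field_simp
  rfl

end

/-! ### Hankel's formula for `1/Γ` -/

/-- The integral `(1 / 2πi) ∫ e^σ F(σ) dσ` over the Hankel contour through `c` with directions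
`w` and `conj w`, for `F` symmetric under conjugation. -/
def contourIntegral (c : ℝ) (w : ℂ) (F : ℂ → ℂ) : ℝ :=
  Real.pi⁻¹ * ((∫ r in Ioi (0 : ℝ), Complex.exp (ray c w r) * F (ray c w r)) * w).im

namespace IsContourDir

variable {w : ℂ} {c : ℝ}

theorem hasDerivAt_exp_mul_cpow {σ a : ℂ} (hσ : σ ∈ Complex.slitPlane) :
    HasDerivAt (fun σ => Complex.exp σ * σ ^ a)
      (Complex.exp σ * σ ^ a + a * (Complex.exp σ * σ ^ (a - 1))) σ := by
  convert! (Complex.hasDerivAt_exp σ).mul ((hasDerivAt_id σ).cpow_const (c := a) hσ) using 1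
  simp only [id]
  ring

/-- Integration by parts along the contour. -/
theorem integral_exp_mul_cpow_parts (hw : IsContourDir w) (hc : 0 < c) (a : ℝ) :
    ((∫ r in Ioi (0 : ℝ), Complex.exp (ray c w r) * ray c w r ^ (a : ℂ)) +
      a * ∫ r in Ioi (0 : ℝ), Complex.exp (ray c w r) * ray c w r ^ ((a - 1 : ℝ) : ℂ)) * w =
      ((-(Real.exp c * c ^ a) : ℝ) : ℂ) := by
  have i1 := hw.integrableOn_exp_mul_cpow hc a
  have i2 := hw.integrableOn_exp_mul_cpow hc (a - 1)
  have h := integral_Ioi_of_hasDerivAt_of_tendsto' (a := 0) (m := 0)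
    (f := fun r => Complex.exp (ray c w r) * ray c w r ^ (a : ℂ))
    (f' := fun r => (Complex.exp (ray c w r) * ray c w r ^ (a : ℂ) +
      a * (Complex.exp (ray c w r) * ray c w r ^ ((a - 1 : ℝ) : ℂ))) * w) ?_
      ((i1.add (i2.const_mul _)).mul_const w) ?_
  · rw [integral_mul_const, integral_add i1 (i2.const_mul _), integral_const_mul] at h
    rw [h, ray_zero, zero_sub]
    push_cast
    rw [Complex.ofReal_cpow hc.le]
  · intro r hr
    have := (hasDerivAt_exp_mul_cpow (a := a) (hw.mem_slitPlane hc hr)).comp r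
      (hasDerivAt_ray c w r)
    push_cast
    exact this
  · rw [tendsto_zero_iff_norm_tendsto_zero]
    simp_rw [norm_exp_mul_cpow_ray]
    have hk : 0 < -w.re / 2 := by linarith [hw.re_neg]
    have h0 : Tendsto (fun r : ℝ => Real.exp c * Real.exp (-w.re / 2 * c) *
        Real.exp (-(-w.re / 2 * r))) atTop (𝓝 0) := by
      have := (Real.tendsto_exp_neg_atTop_nhds_zero.comp
        (tendsto_id.const_mul_atTop hk)).const_mul (Real.exp c * Real.exp (-w.re / 2 * c))
      simpa using this
    obtain ⟨C, hC⟩ := ((rpow_mul_exp_rpow_isBigO (X := 0) zero_lt_one a hk).comp_tendsto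
      (hw.tendsto_norm_ray (c := c))).bound
    refine squeeze_zero' (Eventually.of_forall fun r => by positivity) ?_
      (by simpa using h0.const_mul |C|)
    filter_upwards [hC, eventually_ge_atTop 0] with r hr hr0
    simp only [Function.comp, zero_mul, Real.exp_zero, mul_one] at hr
    rw [Real.norm_of_nonneg (by positivity), Real.norm_of_nonneg (Real.exp_pos _).le] at hr
    calc Real.exp (ray c w r).re * ‖ray c w r‖ ^ a
        ≤ Real.exp (ray c w r).re * (|C| * Real.exp (-w.re / 2 * (c + r))) := by
          refine mul_le_mul_of_nonneg_left (hr.trans ?_) (Real.exp_pos _).le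
          exact mul_le_mul (le_abs_self C) (Real.exp_le_exp.2
            (mul_le_mul_of_nonneg_left (hw.norm_ray_le hc.le hr0) hk.le)) (Real.exp_pos _).le
            (abs_nonneg C)
      _ = _ := by
          rw [ray_re, ← Real.exp_add, mul_left_comm, ← Real.exp_add, ← Real.exp_add]
          congr 2
          ring

/-- The boundary term of the integration by parts sits at the real apex, hence is real and
disappears in the imaginary part. -/
theorem contourIntegral_cpow_sub_one (hw : IsContourDir w) (hc : 0 < c) (a : ℝ) :
    contourIntegral c w (fun σ => σ ^ (a : ℂ)) =
      -a * contourIntegral c w (fun σ => σ ^ ((a - 1 : ℝ) : ℂ)) := by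
  have := congrArg Complex.im (hw.integral_exp_mul_cpow_parts hc a)
  rw [Complex.ofReal_im, add_mul, Complex.add_im, mul_assoc, Complex.im_ofReal_mul] at this
  simp only [contourIntegral]
  linear_combination Real.pi⁻¹ * this

/-- The contour integral of a power does not depend on the apex. -/
theorem contourIntegral_cpow_eq (hw : IsContourDir w) {a : ℝ} (ha : a < 0) {c₁ c₂ : ℝ}
    (h₁ : 0 < c₁) (h₂ : 0 < c₂) :
    contourIntegral c₁ w (fun σ => σ ^ (a : ℂ)) =
      contourIntegral c₂ w (fun σ => σ ^ (a : ℂ)) := by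
  -- Moving the apex differentiates `e^σ σ^a` in `σ`, and `w` times the result is the derivative
  -- along the ray. The integral is therefore the real boundary term, with imaginary part zero.
  have hd : ∀ c : ℝ, 0 < c →
      HasDerivAt (fun c => contourIntegral c w (fun σ => σ ^ (a : ℂ))) 0 c := by
    intro c hc
    have hs : Ioo (c / 2) (2 * c) ∈ 𝓝 c := Ioo_mem_nhds (by linarith) (by linarith)
    have hm : ∀ {x s : ℝ}, 0 < x → AEStronglyMeasurable
        (fun r => Complex.exp (ray x w r) * ray x w r ^ (s : ℂ)) (volume.restrict (Ioi 0)) :=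
      fun hx => (hw.integrableOn_exp_mul_cpow hx _).aestronglyMeasurable
    have him := hw.im_pos
    have hb : ∀ {s x r : ℝ}, s < 0 → 0 < r → x ∈ Ioo (c / 2) (2 * c) →
        ‖Complex.exp (ray x w r) * ray x w r ^ (s : ℂ)‖ ≤
          Real.exp (2 * c) * (c / 2 * w.im) ^ s * Real.exp (-(-w.re) * r) := by
      intro s x r hs hr hx
      rw [norm_exp_mul_cpow_ray, ray_re]
      have e1 : Real.exp (x + r * w.re) ≤ Real.exp (2 * c) * Real.exp (-(-w.re) * r) := by
        rw [← Real.exp_add]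
        exact Real.exp_le_exp.2 (by linarith [hx.2])
      have e2 : ‖ray x w r‖ ^ s ≤ (c / 2 * w.im) ^ s := by
        refine Real.rpow_le_rpow_of_nonpos (by positivity) ?_ hs.le
        exact (mul_le_mul_of_nonneg_right hx.1.le him.le).trans hw.mul_im_le_norm_ray
      calc _ ≤ Real.exp (2 * c) * Real.exp (-(-w.re) * r) * (c / 2 * w.im) ^ s :=
            mul_le_mul e1 e2 (by positivity) (by positivity)
        _ = _ := by ring
    have hexp : IntegrableOn (fun r => Real.exp (-(-w.re) * r)) (Ioi 0) :=
      exp_neg_integrableOn_Ioi 0 (neg_pos.2 hw.re_neg)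
    have key := (hasDerivAt_integral_of_dominated_loc_of_deriv_le (μ := volume.restrict (Ioi 0))
      (F := fun (c : ℝ) r => Complex.exp (ray c w r) * ray c w r ^ (a : ℂ))
      (F' := fun (c : ℝ) r => Complex.exp (ray c w r) * ray c w r ^ (a : ℂ) +
        a * (Complex.exp (ray c w r) * ray c w r ^ ((a - 1 : ℝ) : ℂ)))
      (bound := fun r => Real.exp (2 * c) * (c / 2 * w.im) ^ a * Real.exp (-(-w.re) * r) +
        |a| * (Real.exp (2 * c) * (c / 2 * w.im) ^ (a - 1) * Real.exp (-(-w.re) * r)))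
      (x₀ := c) hs ?_ (hw.integrableOn_exp_mul_cpow hc a)
      ((hm hc).add ((hm hc).const_mul _)) ?_ ((hexp.const_mul _).add
        ((hexp.const_mul _).const_mul _)) ?_).2
    · have i1 := hw.integrableOn_exp_mul_cpow hc a
      have i2 := hw.integrableOn_exp_mul_cpow hc (a - 1)
      rw [integral_add i1 (i2.const_mul _), integral_const_mul] at key
      have k2 := (Complex.imCLM.hasFDerivAt.comp_hasDerivAt c (key.mul_const w)).const_mul
        Real.pi⁻¹
      rw [hw.integral_exp_mul_cpow_parts hc a, Complex.imCLM_apply, Complex.ofReal_im,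
        mul_zero] at k2
      exact k2
    · filter_upwards [lt_mem_nhds hc] with x hx using hm hx
    · filter_upwards [ae_restrict_mem measurableSet_Ioi] with r hr x hx
      refine (norm_add_le _ _).trans (add_le_add (hb ha hr hx) ?_)
      rw [norm_mul, Complex.norm_real]
      exact mul_le_mul_of_nonneg_left (hb (by linarith) hr hx) (abs_nonneg a)
    · filter_upwards [ae_restrict_mem measurableSet_Ioi] with r hr x hx
      have hx0 : 0 < x := (half_pos hc).trans hx.1
      have := (hasDerivAt_exp_mul_cpow (a := a) (hw.mem_slitPlane hx0 (le_of_lt hr))).comp x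
        (hasDerivAt_ray_left x w r)
      rw [mul_one] at this
      push_cast
      exact this
  exact isOpen_Ioi.is_const_of_deriv_eq_zero (convex_Ioi 0).isPreconnected
    (fun z hz => (hd z hz).differentiableAt.differentiableWithinAt)
    (fun z hz => (hd z hz).deriv) h₁ h₂

/-- For `z < 1` the singularity `σ^{-z}` is integrable at the origin, so the apex may tend to `0`
without changing the value. The limit is a Gamma integral with parameter `1 - z` and `ζ = -w` in the
right half-plane; the reflection formula turns it into `1/Γ(z)`. -/
theorem hankel_of_mem_Ioo (hw : IsContourDir w) (hc : 0 < c) {z : ℝ} (h0 : 0 < z) (h1 : z < 1) :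
    contourIntegral c w (fun σ => σ ^ ((-z : ℝ) : ℂ)) = (Real.Gamma z)⁻¹ := by
  have him := hw.im_pos
  set b : ℝ := 1 - z with hbdef
  have hb0 : 0 < b := by linarith
  have hlim : Tendsto (fun c => contourIntegral c w (fun σ => σ ^ ((-z : ℝ) : ℂ))) (𝓝[>] 0)
      (𝓝 (Real.pi⁻¹ * ((∫ r in Ioi (0 : ℝ), w ^ ((-z : ℝ) : ℂ) *
        (((r ^ (b - 1) : ℝ) : ℂ) * Complex.exp (-(-w * r)))) * w).im)) := by
    refine (Tendsto.const_mul _ ((Complex.continuous_im.tendsto _).comp (Tendsto.mul_const w ?_)))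
    refine tendsto_integral_filter_of_dominated_convergence
      (fun r => Real.exp 1 * w.im ^ (-z) * (r ^ (b - 1) * Real.exp (-(-w.re * r)))) ?_ ?_ ?_ ?_
    · filter_upwards [self_mem_nhdsWithin] with x hx
      exact (hw.integrableOn_exp_mul_cpow hx _).aestronglyMeasurable
    · filter_upwards [Ioo_mem_nhdsGT one_pos] with x hx
      filter_upwards [ae_restrict_mem measurableSet_Ioi] with r hr
      have hr' : 0 < r := hr
      rw [norm_exp_mul_cpow_ray, ray_re]
      have e1 : Real.exp (x + r * w.re) ≤ Real.exp 1 * Real.exp (-(-w.re * r)) := by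
        rw [← Real.exp_add]
        exact Real.exp_le_exp.2 (by linarith [hx.2])
      have e2 : ‖ray x w r‖ ^ (-z) ≤ (r * w.im) ^ (-z) :=
        Real.rpow_le_rpow_of_nonpos (by positivity) mul_im_le_norm_ray' (by linarith)
      calc _ ≤ Real.exp 1 * Real.exp (-(-w.re * r)) * (r * w.im) ^ (-z) :=
            mul_le_mul e1 e2 (by positivity) (by positivity)
        _ = _ := by
          rw [Real.mul_rpow hr'.le him.le, show b - 1 = -z by rw [hbdef]; ring]
          ring
    · refine Integrable.const_mul ?_ _
      by_contra h
      have h2 := integral_undef h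
      have h3 : 0 < -w.re := neg_pos.2 hw.re_neg
      rw [Real.integral_rpow_mul_exp_neg_mul_Ioi hb0 h3] at h2
      have := mul_pos (Real.rpow_pos_of_pos (one_div_pos.2 h3) b) (Real.Gamma_pos_of_pos hb0)
      exact this.ne' h2
    · filter_upwards [ae_restrict_mem measurableSet_Ioi] with r hr
      have hr' : 0 < r := hr
      have hrw : (r : ℂ) * w ∈ Complex.slitPlane := by
        rw [Complex.mem_slitPlane_iff]
        right
        simpa using ⟨hr'.ne', him.ne'⟩
      have h2 : ContinuousAt (fun σ : ℂ => Complex.exp σ * σ ^ ((-z : ℝ) : ℂ)) (r * w) :=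
        (hasDerivAt_exp_mul_cpow hrw).continuousAt
      have h3 : Tendsto (fun c : ℝ => ray c w r) (𝓝[>] 0) (𝓝 (r * w)) := by
        have := (hasDerivAt_ray_left 0 w r).continuousAt.tendsto
        simp only [ray, Complex.ofReal_zero, zero_add] at this
        exact this.mono_left nhdsWithin_le_nhds
      have h4 := h2.tendsto.comp h3
      have hmul : ((r : ℂ) * w) ^ ((-z : ℝ) : ℂ) =
          ((r ^ (b - 1) : ℝ) : ℂ) * w ^ ((-z : ℝ) : ℂ) := by
        rw [Complex.ofReal_cpow hr'.le, show b - 1 = -z by rw [hbdef]; ring,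
          Complex.cpow_def_of_ne_zero (mul_ne_zero (by simpa using hr'.ne') hw.ne_zero),
          Complex.cpow_def_of_ne_zero hw.ne_zero,
          Complex.cpow_def_of_ne_zero (by simpa using hr'.ne'), ← Complex.exp_add,
          Complex.log_ofReal_mul hr' hw.ne_zero, Complex.ofReal_log hr'.le, add_mul]
      rw [hmul, mul_comm (Complex.exp _)] at h4
      rw [show -(-w * (r : ℂ)) = r * w by ring, ← mul_assoc, mul_comm (w ^ _)]
      exact h4.congr fun _ => rfl
  have hval := integral_rpow_mul_cexp_neg_mul_Ioi hb0 (ζ := -w) (by simpa using hw.re_neg)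
  rw [integral_const_mul, hval] at hlim
  have hconst : Tendsto (fun c => contourIntegral c w (fun σ => σ ^ ((-z : ℝ) : ℂ))) (𝓝[>] 0)
      (𝓝 (contourIntegral c w (fun σ => σ ^ ((-z : ℝ) : ℂ)))) := by
    refine tendsto_const_nhds.congr' ?_
    filter_upwards [self_mem_nhdsWithin] with x hx
    exact hw.contourIntegral_cpow_eq (by linarith) hc hx
  rw [tendsto_nhds_unique hconst hlim]
  have hw0 := hw.ne_zero
  -- The direction cancels except for a phase: `w^b (-w)^{-b} = e^{iπb}`, because `arg (-w) = arg w
  -- - π`.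
  have e1 : w ^ ((-z : ℝ) : ℂ) * (Complex.Gamma b * (-w) ^ (-b : ℂ)) * w =
      (Real.Gamma b : ℂ) * Complex.exp (((Real.pi * b : ℝ) : ℂ) * Complex.I) := by
    have e2 : w ^ ((-z : ℝ) : ℂ) * w = w ^ (b : ℂ) := by
      nth_rw 2 [← Complex.cpow_one w]
      rw [← Complex.cpow_add _ _ hw0]
      congr 1
      rw [hbdef]
      push_cast
      ring
    rw [Complex.Gamma_ofReal, mul_right_comm, e2, mul_left_comm]
    congr 1
    rw [Complex.cpow_def_of_ne_zero hw0, Complex.cpow_def_of_ne_zero (neg_ne_zero.2 hw0),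
      ← Complex.exp_add]
    congr 1
    rw [Complex.log, Complex.log, norm_neg, Complex.arg_neg_eq_arg_sub_pi_of_im_pos him]
    push_cast
    ring
  rw [e1, Complex.im_ofReal_mul, Complex.exp_ofReal_mul_I_im]
  have hG := Real.Gamma_mul_Gamma_one_sub b
  rw [show 1 - b = z by rw [hbdef]; ring] at hG
  have hs : 0 < Real.sin (Real.pi * b) := by
    apply Real.sin_pos_of_pos_of_lt_pi (by positivity)
    have : b < 1 := by linarith
    nlinarith [Real.pi_pos]
  have hz := Real.Gamma_pos_of_pos h0
  have hpi := Real.pi_pos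
  field_simp at hG ⊢
  linarith

/-- Both sides are continuous at `1` and agree to its left. For exponents between `0` and `2`,
`|σ|^{-z} ≤ 1 + |σ|^{-2}` supplies the majorant. -/
theorem hankel_one (hw : IsContourDir w) (hc : 0 < c) :
    contourIntegral c w (fun σ => σ ^ ((-1 : ℝ) : ℂ)) = (Real.Gamma 1)⁻¹ := by
  have h1 : ContinuousAt (fun z : ℝ => contourIntegral c w (fun σ => σ ^ ((-z : ℝ) : ℂ))) 1 := by
    refine ContinuousAt.mul continuousAt_const
      (Complex.continuous_im.continuousAt.comp (ContinuousAt.mul ?_ continuousAt_const))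
    refine continuousAt_of_dominated (bound := fun r => Real.exp (ray c w r).re *
      ‖ray c w r‖ ^ (0 : ℝ) + Real.exp (ray c w r).re * ‖ray c w r‖ ^ (-2 : ℝ)) ?_ ?_
      ((hw.integrableOn_exp_mul_rpow hc _).add (hw.integrableOn_exp_mul_rpow hc _)) ?_
    · exact Eventually.of_forall fun z => (hw.integrableOn_exp_mul_cpow hc _).aestronglyMeasurable
    · filter_upwards [Ioo_mem_nhds (zero_lt_one' ℝ) one_lt_two] with z hz
      filter_upwards [ae_restrict_mem measurableSet_Ioi] with r hr
      have hn := hw.norm_ray_pos hc (le_of_lt hr)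
      rw [norm_exp_mul_cpow_ray, ← mul_add]
      refine mul_le_mul_of_nonneg_left ?_ (Real.exp_pos _).le
      rcases le_total 1 ‖ray c w r‖ with h | h
      · have := Real.rpow_le_rpow_of_exponent_le h (show -z ≤ 0 by linarith [hz.1])
        exact this.trans (le_add_of_nonneg_right (Real.rpow_nonneg hn.le _))
      · have := Real.rpow_le_rpow_of_exponent_ge hn h (show -2 ≤ -z by linarith [hz.2])
        exact this.trans (le_add_of_nonneg_left (Real.rpow_nonneg hn.le _))
    · filter_upwards [ae_restrict_mem measurableSet_Ioi] with r hr
      refine ContinuousAt.mul continuousAt_const (ContinuousAt.const_cpow ?_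
        (Or.inl (hw.ray_ne_zero hc (le_of_lt hr))))
      fun_prop
  have h2 : ContinuousAt (fun z : ℝ => (Real.Gamma z)⁻¹) 1 :=
    (Real.differentiableAt_Gamma fun m h => by
      have : (0 : ℝ) ≤ m := m.cast_nonneg
      linarith).continuousAt.inv₀ (by simp)
  refine tendsto_nhds_unique (h1.tendsto.mono_left nhdsWithin_le_nhds)
    ((h2.tendsto.mono_left (nhdsWithin_le_nhds (s := Iio 1))).congr' ?_)
  filter_upwards [Ioo_mem_nhdsLT (zero_lt_one' ℝ)] with z hz
  exact (hw.hankel_of_mem_Ioo hc hz.1 hz.2).symm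

/-- Hankel's formula for the reciprocal Gamma function. -/
theorem hankel (hw : IsContourDir w) (hc : 0 < c) (z : ℝ) :
    contourIntegral c w (fun σ => σ ^ ((-z : ℝ) : ℂ)) = (Real.Gamma z)⁻¹ := by
  -- Both sides satisfy `F(z) = z F(z+1)`. This propagates equality from `(0, 1]` upwards by
  -- division and downwards by multiplication. At `z = 0` the factor `z` produces the zero that
  -- `(Real.Gamma 0)⁻¹ = 0` encodes.
  have hrec : ∀ z : ℝ, contourIntegral c w (fun σ => σ ^ ((-z : ℝ) : ℂ)) =
      z * contourIntegral c w (fun σ => σ ^ ((-(z + 1) : ℝ) : ℂ)) := by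
    intro z
    rw [hw.contourIntegral_cpow_sub_one hc (-z), neg_neg, show -z - 1 = -(z + 1) by ring]
  have hG : ∀ z : ℝ, (Real.Gamma z)⁻¹ = z * (Real.Gamma (z + 1))⁻¹ := by
    intro z
    rcases eq_or_ne z 0 with rfl | hz
    · simp
    · rw [Real.Gamma_add_one hz]
      field_simp
  have hbase : ∀ z : ℝ, 0 < z → z ≤ 1 →
      contourIntegral c w (fun σ => σ ^ ((-z : ℝ) : ℂ)) = (Real.Gamma z)⁻¹ := by
    intro z h0 h1
    rcases h1.lt_or_eq with h | rfl
    · exact hw.hankel_of_mem_Ioo hc h0 h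
    · exact hw.hankel_one hc
  have hup : ∀ (n : ℕ) (z : ℝ), 0 < z → z ≤ n + 1 →
      contourIntegral c w (fun σ => σ ^ ((-z : ℝ) : ℂ)) = (Real.Gamma z)⁻¹ := by
    intro n
    induction n with
    | zero => intro z h0 h1; exact hbase z h0 (by simpa using h1)
    | succ n ih =>
      intro z h0 h1
      rcases le_or_gt z 1 with h | h
      · exact hbase z h0 h
      · have h2 := ih (z - 1) (by linarith) (by push_cast at h1; linarith)
        rw [hrec, hG, sub_add_cancel] at h2
        exact mul_left_cancel₀ (by linarith : z - 1 ≠ 0) h2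
  have hdown : ∀ (n : ℕ) (z : ℝ), -n < z →
      contourIntegral c w (fun σ => σ ^ ((-z : ℝ) : ℂ)) = (Real.Gamma z)⁻¹ := by
    intro n
    induction n with
    | zero =>
      intro z h0
      obtain ⟨m, hm⟩ := exists_nat_ge z
      exact hup m z (by simpa using h0) (by linarith)
    | succ n ih =>
      intro z h0
      rw [hrec, hG, ih (z + 1) (by push_cast at h0; linarith)]
  obtain ⟨m, hm⟩ := exists_nat_gt (-z)
  exact hdown m z (by linarith)

end IsContourDir

/-! ### Contour integrals, decay and moments of Wright functions -/

section

variable {w : ℂ} {c γ : ℝ}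

/-- Any angle strictly between `π/2` and `min(π, π/(2γ))` works; the interval is nonempty because `γ
< 1`. Then `e^σ` decays along the ray while `σ^γ` stays in a sector inside the right half-plane. -/
theorem exists_contourDir (h0 : 0 < γ) (h1 : γ < 1) :
    ∃ w : ℂ, IsContourDir w ∧ w.arg * γ < Real.pi / 2 := by
  have hpi := Real.pi_pos
  have h2 : Real.pi / 2 < min Real.pi (Real.pi / 2 / γ) := by
    refine lt_min (by linarith) ?_
    rw [lt_div_iff₀ h0]
    nlinarith
  obtain ⟨φ, hφ1, hφ2⟩ := exists_between h2
  have hφ3 := hφ2.trans_le (min_le_left _ _)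
  have hφ4 := hφ2.trans_le (min_le_right _ _)
  refine ⟨Complex.exp (φ * Complex.I), ⟨Complex.norm_exp_ofReal_mul_I φ, ?_, ?_⟩, ?_⟩
  · rw [Complex.exp_ofReal_mul_I_re]
    exact Real.cos_neg_of_pi_div_two_lt_of_lt hφ1 (by linarith)
  · rw [Complex.exp_ofReal_mul_I_im]
    exact Real.sin_pos_of_pos_of_lt_pi (by linarith) hφ3
  · rw [Complex.exp_mul_I, Complex.arg_cos_add_sin_mul_I ⟨by linarith, hφ3.le⟩]
    rwa [lt_div_iff₀ h0] at hφ4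

namespace IsContourDir

theorem cos_pos (hw : IsContourDir w) (h0 : 0 < γ) (hγ : w.arg * γ < Real.pi / 2) :
    0 < Real.cos (w.arg * γ) := by
  have := Complex.arg_nonneg_iff.2 hw.im_pos.le
  exact Real.cos_pos_of_mem_Ioo ⟨by nlinarith [Real.pi_pos], hγ⟩

/-- The angle of `σ^γ` lies between `0` and `γ arg w < π/2`, where the cosine decreases. -/
theorem cos_mul_le_re_cpow (hw : IsContourDir w) (hc : 0 < c) (h0 : 0 < γ)
    (hγ : w.arg * γ < Real.pi / 2) {r : ℝ} (hr : 0 ≤ r) :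
    Real.cos (w.arg * γ) * ‖ray c w r‖ ^ γ ≤ (ray c w r ^ (γ : ℂ)).re := by
  rw [Complex.cpow_ofReal_re, mul_comm]
  refine mul_le_mul_of_nonneg_left ?_ (by positivity)
  have h1 := hw.arg_ray_nonneg (c := c) hr
  apply Real.cos_le_cos_of_nonneg_of_le_pi
  · positivity
  · linarith [Real.pi_pos]
  · exact mul_le_mul_of_nonneg_right (hw.arg_ray_le hc hr) h0.le

/-- Lower bound for `Re σ^γ` on the contour. -/
theorem apex_le_re_cpow (hw : IsContourDir w) (hc : 0 < c) (h0 : 0 < γ)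
    (hγ : w.arg * γ < Real.pi / 2) {r : ℝ} (hr : 0 ≤ r) :
    Real.cos (w.arg * γ) * (c * w.im) ^ γ ≤ (ray c w r ^ (γ : ℂ)).re := by
  refine le_trans ?_ (hw.cos_mul_le_re_cpow hc h0 hγ hr)
  refine mul_le_mul_of_nonneg_left ?_ (hw.cos_pos h0 hγ).le
  have := hw.im_pos
  exact Real.rpow_le_rpow (by positivity) hw.mul_im_le_norm_ray h0.le

/-- With the apex far to the right, `Re σ^γ` is as large as desired on the contour. -/
theorem exists_apex (hw : IsContourDir w) (h0 : 0 < γ) (hγ : w.arg * γ < Real.pi / 2) (m : ℝ) :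
    ∃ c : ℝ, 0 < c ∧ ∀ r : ℝ, 0 ≤ r → m ≤ (ray c w r ^ (γ : ℂ)).re := by
  have h1 : Tendsto (fun c : ℝ => Real.cos (w.arg * γ) * (c * w.im) ^ γ) atTop atTop :=
    ((tendsto_rpow_atTop h0).comp (tendsto_id.atTop_mul_const hw.im_pos)).const_mul_atTop
      (hw.cos_pos h0 hγ)
  obtain ⟨c, hc, hc0⟩ := ((h1.eventually_ge_atTop m).and (eventually_gt_atTop 0)).exists
  exact ⟨c, hc0, fun r hr => hc.trans (hw.apex_le_re_cpow hc0 h0 hγ hr)⟩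

/-- Termwise integration: the Wright function as a contour integral. -/
theorem wright_eq (hw : IsContourDir w) (hc : 0 < c) (h1 : γ < 1) (μ ξ : ℝ) :
    wright (-γ) μ (-ξ) = ((contourIntegral c w fun σ =>
      σ ^ ((-μ : ℝ) : ℂ) * Complex.exp (-(ξ * σ ^ (γ : ℂ))) : ℝ) : ℂ) := by
  have hexp : ∀ z : ℂ, HasSum (fun n : ℕ => z ^ n / n.factorial) (Complex.exp z) := by
    intro z
    rw [Complex.exp_eq_exp_ℂ]
    exact NormedSpace.expSeries_div_hasSum_exp z
  have hexpR : ∀ x : ℝ, HasSum (fun n : ℕ => x ^ n / n.factorial) (Real.exp x) := by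
    intro x
    rw [Real.exp_eq_exp_ℝ]
    exact NormedSpace.expSeries_div_hasSum_exp x
  have hpow : ∀ n : ℕ, ∀ r ∈ Ioi (0 : ℝ), Complex.exp (ray c w r) * (ray c w r ^ ((-μ : ℝ) : ℂ) *
      ((-(ξ * ray c w r ^ (γ : ℂ))) ^ n / n.factorial)) =
      (((-ξ) ^ n / n.factorial : ℝ) : ℂ) *
        (Complex.exp (ray c w r) * ray c w r ^ ((-(μ - γ * n) : ℝ) : ℂ)) := by
    intro n r hr
    have h := hw.ray_ne_zero hc (le_of_lt hr)
    rw [show ((-(μ - γ * n) : ℝ) : ℂ) = ((-μ : ℝ) : ℂ) + (n : ℂ) * γ by push_cast; ring,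
      Complex.cpow_add _ _ h, Complex.cpow_nat_mul]
    push_cast
    rw [← neg_mul, mul_pow]
    ring
  have hsum : HasSum (fun n : ℕ => ∫ r in Ioi (0 : ℝ), Complex.exp (ray c w r) *
      (ray c w r ^ ((-μ : ℝ) : ℂ) * ((-(ξ * ray c w r ^ (γ : ℂ))) ^ n / n.factorial)))
      (∫ r in Ioi (0 : ℝ), Complex.exp (ray c w r) * (ray c w r ^ ((-μ : ℝ) : ℂ) *
        Complex.exp (-(ξ * ray c w r ^ (γ : ℂ))))) := by
    have hb : ∀ r : ℝ, HasSum (fun n : ℕ => Real.exp (ray c w r).re * (‖ray c w r‖ ^ (-μ) *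
        ((|ξ| * ‖ray c w r‖ ^ γ) ^ n / n.factorial))) (Real.exp (ray c w r).re *
        (‖ray c w r‖ ^ (-μ) * Real.exp (|ξ| * ‖ray c w r‖ ^ γ))) := by
      intro r
      exact ((hexpR _).mul_left _).mul_left _
    -- The absolute series sums to `exp(|ξ| |σ|^γ)`, which the decay of `e^σ` absorbs because `γ <
    -- 1`.
    refine hasSum_integral_of_dominated_convergence (fun n r => Real.exp (ray c w r).re *
      (‖ray c w r‖ ^ (-μ) * ((|ξ| * ‖ray c w r‖ ^ γ) ^ n / n.factorial))) ?_ ?_ ?_ ?_ ?_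
    · intro n
      refine (((hw.integrableOn_exp_mul_cpow hc (-(μ - γ * n))).const_mul
        (((-ξ) ^ n / n.factorial : ℝ) : ℂ)).congr ?_).aestronglyMeasurable
      filter_upwards [ae_restrict_mem measurableSet_Ioi] with r hr using (hpow n r hr).symm
    · intro n
      refine Eventually.of_forall fun r => le_of_eq ?_
      rw [norm_mul, norm_mul, norm_div, norm_pow, norm_neg, norm_mul, Complex.norm_cpow_real,
        Complex.norm_cpow_real, Complex.norm_exp, Complex.norm_real, Complex.norm_natCast,
        Real.norm_eq_abs]
    · exact Eventually.of_forall fun r => (hb r).summable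
    · simp_rw [(hb _).tsum_eq]
      exact hw.integrableOn_majorant hc h1 _ _
    · refine Eventually.of_forall fun r => ?_
      exact ((hexp _).mul_left _).mul_left _
  have h2 := (Complex.hasSum_ofReal.2 ((Complex.imCLM.hasSum (hsum.mul_right w)).mul_left
    Real.pi⁻¹)).tsum_eq
  rw [contourIntegral, wright]
  refine Eq.trans (tsum_congr fun n => ?_) h2
  rw [setIntegral_congr_fun measurableSet_Ioi (hpow n), integral_const_mul,
    mul_assoc, Complex.imCLM_apply, Complex.im_ofReal_mul, mul_left_comm]
  -- Here `μ - γn` may be zero or negative, even a pole of `Γ`, so Hankel's formula is needed for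
  -- all real arguments.
  have h3 := hw.hankel hc (μ - γ * n)
  rw [contourIntegral] at h3
  rw [h3, show ((-γ : ℝ) : ℂ) * n + μ = ((μ - γ * n : ℝ) : ℂ) by push_cast; ring,
    Complex.Gamma_ofReal]
  push_cast
  rw [div_mul_eq_mul_div, mul_comm (n.factorial : ℂ), ← div_div, div_eq_mul_inv (_ ^ n)]

end IsContourDir

/-- The kernel of the contour integral for the Wright function. -/
def wrightKernel (c : ℝ) (w : ℂ) (γ μ ξ r : ℝ) : ℂ :=
  Complex.exp (ray c w r) * (ray c w r ^ ((-μ : ℝ) : ℂ) *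
    Complex.exp (-(ξ * ray c w r ^ (γ : ℂ))))

theorem measurable_wrightKernel (c : ℝ) (w : ℂ) (γ μ : ℝ) :
    Measurable (Function.uncurry (wrightKernel c w γ μ)) := by
  have h : Measurable fun p : ℝ × ℝ => ray c w p.2 :=
    (continuous_ray c w).measurable.comp measurable_snd
  have h1 : ∀ s : ℂ, Measurable fun p : ℝ × ℝ => ray c w p.2 ^ s := fun s => h.pow_const s
  have h2 : Measurable fun p : ℝ × ℝ => (p.1 : ℂ) :=
    Complex.measurable_ofReal.comp measurable_fst
  exact (Complex.measurable_exp.comp h).mul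
    ((h1 _).mul (Complex.measurable_exp.comp (h2.mul (h1 _)).neg))

theorem norm_wrightKernel_le {m μ ξ r : ℝ} (hξ : 0 ≤ ξ) (hm : m ≤ (ray c w r ^ (γ : ℂ)).re) :
    ‖wrightKernel c w γ μ ξ r‖ ≤
      Real.exp (-(m * ξ)) * (Real.exp (ray c w r).re * ‖ray c w r‖ ^ (-μ)) := by
  rw [wrightKernel, ← mul_assoc, norm_mul, norm_exp_mul_cpow_ray, Complex.norm_exp, mul_comm]
  refine mul_le_mul_of_nonneg_right (Real.exp_le_exp.2 ?_) (by positivity)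
  rw [Complex.neg_re, Complex.re_ofReal_mul, mul_comm m]
  exact neg_le_neg (mul_le_mul_of_nonneg_left hm hξ)

/-- The contour formula holds for every apex, so the apex may be chosen with `Re σ^γ ≥ m` on the
whole contour. The arbitrary rate `m` is what later beats the exponential growth of the
Mittag-Leffler majorant. -/
theorem exists_norm_wright_le (h0 : 0 < γ) (h1 : γ < 1) (μ m : ℝ) :
    ∃ C : ℝ, 0 ≤ C ∧ ∀ ξ : ℝ, 0 ≤ ξ → ‖wright (-γ) μ (-ξ)‖ ≤ C * Real.exp (-(m * ξ)) := by
  obtain ⟨w, hw, hγ⟩ := exists_contourDir h0 h1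
  obtain ⟨c, hc, hm⟩ := hw.exists_apex h0 hγ m
  refine ⟨Real.pi⁻¹ * ∫ r in Ioi (0 : ℝ), Real.exp (ray c w r).re * ‖ray c w r‖ ^ (-μ), ?_, ?_⟩
  · have := Real.pi_pos
    exact mul_nonneg (by positivity) (integral_nonneg fun r => by positivity)
  intro ξ hξ
  rw [hw.wright_eq hc h1, Complex.norm_real, contourIntegral, norm_mul, Real.norm_eq_abs,
    abs_of_nonneg (inv_nonneg.2 Real.pi_pos.le), mul_assoc]
  refine mul_le_mul_of_nonneg_left ?_ (inv_nonneg.2 Real.pi_pos.le)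
  refine (Complex.abs_im_le_norm _).trans ?_
  rw [norm_mul, hw.norm_eq, mul_one, mul_comm, ← integral_const_mul]
  refine norm_integral_le_of_norm_le ((hw.integrableOn_exp_mul_rpow hc (-μ)).const_mul _) ?_
  filter_upwards [ae_restrict_mem measurableSet_Ioi] with r hr
  exact norm_wrightKernel_le hξ (hm r (le_of_lt hr))

theorem aestronglyMeasurable_wright (h0 : 0 < γ) (h1 : γ < 1) (μ : ℝ) (ν : Measure ℝ) :
    AEStronglyMeasurable (fun ξ : ℝ => wright (-γ) μ (-ξ)) ν := by
  obtain ⟨w, hw, hγ⟩ := exists_contourDir h0 h1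
  simp_rw [hw.wright_eq one_pos h1]
  have h := (measurable_wrightKernel 1 w γ μ).stronglyMeasurable.integral_prod_right
    (ν := volume.restrict (Ioi 0))
  exact (Complex.measurable_ofReal.comp ((Complex.measurable_im.comp
    (h.measurable.mul_const w)).const_mul Real.pi⁻¹)).aestronglyMeasurable

/-- Integrals against the Wright function are contour integrals of Laplace transforms. -/
theorem IsContourDir.integral_wright_mul (hw : IsContourDir w) (hc : 0 < c) (h1 : γ < 1)
    {μ m : ℝ} (hm : ∀ r : ℝ, 0 ≤ r → m ≤ (ray c w r ^ (γ : ℂ)).re) {f : ℝ → ℝ}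
    (hf : IntegrableOn (fun ξ => Real.exp (-(m * ξ)) * f ξ) (Ioi 0)) :
    ∫ ξ in Ioi (0 : ℝ), wright (-γ) μ (-ξ) * f ξ = ((contourIntegral c w fun σ =>
      σ ^ ((-μ : ℝ) : ℂ) * ∫ ξ in Ioi (0 : ℝ), (f ξ : ℂ) *
        Complex.exp (-(σ ^ (γ : ℂ) * ξ)) : ℝ) : ℂ) := by
  have hfm : AEStronglyMeasurable f (volume.restrict (Ioi 0)) := by
    have h2 : AEStronglyMeasurable (fun ξ : ℝ => Real.exp (m * ξ)) (volume.restrict (Ioi 0)) :=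
      Measurable.aestronglyMeasurable (by fun_prop)
    refine (h2.mul hf.aestronglyMeasurable).congr (Eventually.of_forall fun ξ => ?_)
    simp only [Pi.mul_apply]
    rw [← mul_assoc, ← Real.exp_add]
    simp
  set K : ℝ → ℝ → ℂ := fun ξ r => wrightKernel c w γ μ ξ r * f ξ with hK
  have hint : Integrable (Function.uncurry K)
      ((volume.restrict (Ioi 0)).prod (volume.restrict (Ioi 0))) := by
    refine (hf.norm.mul_prod (hw.integrableOn_exp_mul_rpow hc (-μ))).mono' ?_ ?_
    · refine (measurable_wrightKernel c w γ μ).aestronglyMeasurable.mul ?_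
      exact (Complex.continuous_ofReal.comp_aestronglyMeasurable hfm).comp_fst
    · rw [Measure.prod_restrict]
      filter_upwards [ae_restrict_mem (measurableSet_Ioi.prod measurableSet_Ioi)] with p hp
      rw [Function.uncurry, hK, norm_mul, Complex.norm_real, norm_mul,
        Real.norm_of_nonneg (Real.exp_pos _).le, mul_right_comm]
      exact mul_le_mul_of_nonneg_right (norm_wrightKernel_le (le_of_lt hp.1)
        (hm _ (le_of_lt hp.2))) (norm_nonneg _)
  -- As `f` is real, it can be moved inside the imaginary part; Fubini then applies to the complex
  -- integral.
  have e1 : ∀ ξ : ℝ, wright (-γ) μ (-ξ) * f ξ =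
      ((Real.pi⁻¹ * Complex.imCLM ((∫ r in Ioi (0 : ℝ), K ξ r) * w) : ℝ) : ℂ) := by
    intro ξ
    rw [hw.wright_eq hc h1, hK]
    simp only
    rw [integral_mul_const, mul_right_comm, Complex.imCLM_apply, Complex.im_mul_ofReal,
      contourIntegral]
    rw [← mul_assoc, Complex.ofReal_mul (Real.pi⁻¹ * _)]
    rfl
  simp_rw [e1]
  rw [integral_complex_ofReal, integral_const_mul, ContinuousLinearMap.integral_comp_comm,
    integral_mul_const, integral_integral_swap hint, contourIntegral, Complex.imCLM_apply]
  · congr 5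
    funext r
    simp only [hK, wrightKernel]
    rw [← integral_const_mul, ← integral_const_mul]
    refine integral_congr_ae (Eventually.of_forall fun ξ => ?_)
    simp only
    rw [mul_comm (ray c w r ^ (γ : ℂ))]
    ring
  · exact hint.integral_prod_left.mul_const w

/-- The moments of the Wright function. -/
theorem integral_wright_mul_rpow (h0 : 0 < γ) (h1 : γ < 1) (μ : ℝ) {s : ℝ} (hs : 0 ≤ s) :
    ∫ ξ in Ioi (0 : ℝ), wright (-γ) μ (-ξ) * ((ξ ^ s : ℝ) : ℂ) =
      ((Real.Gamma (s + 1) / Real.Gamma (μ + γ * (s + 1)) : ℝ) : ℂ) := by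
  obtain ⟨w, hw, hγ⟩ := exists_contourDir h0 h1
  -- With `Re σ^γ ≥ 1` the integral over `ξ` is the complex Gamma integral at `ζ = σ^γ`, and
  -- Hankel's formula evaluates the remaining power of `σ`.
  obtain ⟨c, hc, hm⟩ := hw.exists_apex h0 hγ 1
  have hs1 : 0 < s + 1 := by linarith
  have hf : IntegrableOn (fun ξ : ℝ => Real.exp (-(1 * ξ)) * ξ ^ s) (Ioi 0) := by
    have := Real.GammaIntegral_convergent hs1
    simpa using this
  rw [hw.integral_wright_mul hc h1 hm hf, div_eq_mul_inv, ← hw.hankel hc]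
  congr 1
  simp only [contourIntegral]
  rw [mul_left_comm (Real.Gamma _)]
  congr 1
  rw [← Complex.im_ofReal_mul, ← mul_assoc, ← integral_const_mul]
  congr 2
  refine setIntegral_congr_fun measurableSet_Ioi fun r hr => ?_
  have hr' : 0 < r := hr
  have hre : 0 < (ray c w r ^ (γ : ℂ)).re := (zero_lt_one' ℝ).trans_le (hm r hr'.le)
  have h2 := integral_rpow_mul_cexp_neg_mul_Ioi hs1 hre
  rw [add_sub_cancel_right] at h2
  have hr0 := hw.ray_ne_zero hc hr'.le
  rw [h2, Complex.Gamma_ofReal]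
  -- No branch jump occurs, since `γ arg σ` stays within `(-π, π]`.
  have h3 : (ray c w r ^ (γ : ℂ)) ^ (-((s + 1 : ℝ) : ℂ)) =
      ray c w r ^ ((-(γ * (s + 1)) : ℝ) : ℂ) := by
    have ha := hw.arg_ray_nonneg (c := c) hr'.le
    have hb := hw.arg_ray_le hc hr'.le
    have hlog : (Complex.log (ray c w r) * (γ : ℂ)).im = (ray c w r).arg * γ := by
      rw [Complex.im_mul_ofReal, Complex.log_im]
    have hpi := Real.pi_pos
    rw [← Complex.cpow_mul]
    · push_cast
      ring_nf
    · rw [hlog]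
      nlinarith
    · rw [hlog]
      nlinarith
  have h4 : ray c w r ^ ((-(μ + γ * (s + 1)) : ℝ) : ℂ) =
      ray c w r ^ ((-μ : ℝ) : ℂ) * ray c w r ^ ((-(γ * (s + 1)) : ℝ) : ℂ) := by
    rw [← Complex.cpow_add _ _ hr0]
    congr 1
    push_cast
    ring
  rw [h3, h4]
  ring

end

/-! ### Mittag-Leffler series and subordination -/

theorem rpow_le_exp_mul_Gamma {A s : ℝ} (hA : 0 ≤ A) (hs : 0 ≤ s) :
    A ^ s ≤ Real.exp A * Real.Gamma (s + 1) := by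
  have hs1 : 0 < s + 1 := by linarith
  have hint := Real.GammaIntegral_convergent hs1
  -- Keep only the part `x > A` of the Gamma integral, where `x^s ≥ A^s`.
  have h1 : A ^ s * Real.exp (-A) ≤ Real.Gamma (s + 1) := by
    rw [Real.Gamma_eq_integral hs1, ← integral_exp_neg_Ioi, ← integral_const_mul]
    refine (setIntegral_mono_on ((integrableOn_exp_neg_Ioi A).const_mul _)
      (hint.mono_set (Ioi_subset_Ioi hA)) measurableSet_Ioi fun x hx => ?_).trans
      (setIntegral_mono_set hint ?_ (Ioi_subset_Ioi hA).eventuallyLE)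
    · rw [add_sub_cancel_right, mul_comm]
      exact mul_le_mul_of_nonneg_left (Real.rpow_le_rpow hA (le_of_lt hx) hs) (Real.exp_pos _).le
    · filter_upwards [ae_restrict_mem measurableSet_Ioi] with x hx
      exact mul_nonneg (Real.exp_pos _).le (Real.rpow_nonneg (le_of_lt hx) _)
  calc A ^ s = Real.exp A * (A ^ s * Real.exp (-A)) := by
        rw [mul_left_comm, ← Real.exp_add]
        simp
    _ ≤ _ := mul_le_mul_of_nonneg_left h1 (Real.exp_pos _).le

/-- Apply the lower bound for `Γ` with `A = 1 + (2|z|)^{1/a}`. The `2` yields the geometric factor,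
and the `1` ensures `A ≥ 1`, so that the exponent can be raised by `b - 1 ≥ 0`. At `z = -(κξ)^a` the
growth is only exponential in `ξ`. -/
theorem norm_mittagLeffler_term_le {a b : ℝ} (ha : 0 < a) (hb : 1 ≤ b) (z : ℂ) (n : ℕ) :
    ‖z ^ n / Complex.Gamma ((a * n + b : ℝ) : ℂ)‖ ≤
      (1 / 2) ^ n * Real.exp (1 + (2 * ‖z‖) ^ (1 / a)) := by
  set A : ℝ := 1 + (2 * ‖z‖) ^ (1 / a) with hA
  have h0 : 0 ≤ (2 * ‖z‖) ^ (1 / a) := by positivity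
  have h1 : 1 ≤ A := by linarith
  have hpos : 0 < a * n + b := by positivity
  have hG := Real.Gamma_pos_of_pos hpos
  have h2 : (2 * ‖z‖) ^ n ≤ A ^ (a * n + b - 1) := by
    calc (2 * ‖z‖) ^ n = ((2 * ‖z‖) ^ (1 / a)) ^ (a * n) := by
          rw [← Real.rpow_mul (by positivity), ← mul_assoc, one_div, inv_mul_cancel₀ ha.ne',
            one_mul, Real.rpow_natCast]
      _ ≤ A ^ (a * n) := Real.rpow_le_rpow h0 (by linarith) (by positivity)
      _ ≤ _ := Real.rpow_le_rpow_of_exponent_le h1 (by linarith)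
  have h3 := h2.trans (rpow_le_exp_mul_Gamma (by linarith)
    (show 0 ≤ a * n + b - 1 by have : 0 ≤ a * n := by positivity
                               linarith))
  rw [sub_add_cancel] at h3
  rw [Complex.Gamma_ofReal, norm_div, norm_pow, Complex.norm_real, Real.norm_of_nonneg hG.le,
    div_le_iff₀ hG]
  calc ‖z‖ ^ n = (1 / 2) ^ n * (2 * ‖z‖) ^ n := by
        rw [← mul_pow]
        congr 1
        ring
    _ ≤ (1 / 2) ^ n * (Real.exp A * Real.Gamma (a * n + b)) := by gcongr
    _ = _ := by ring

theorem hasSum_mittagLeffler {a b : ℝ} (ha : 0 < a) (hb : 1 ≤ b) (z : ℂ) :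
    HasSum (fun n : ℕ => z ^ n / Complex.Gamma ((a * n + b : ℝ) : ℂ)) (mittagLeffler a b z) :=
  (Summable.of_norm_bounded (summable_geometric_two.mul_right _)
    (norm_mittagLeffler_term_le ha hb z)).hasSum

theorem continuous_mittagLeffler {a b : ℝ} (ha : 0 < a) (hb : 1 ≤ b) :
    Continuous (mittagLeffler a b) := by
  rw [continuous_iff_continuousAt]
  intro z
  have h : ContinuousOn (mittagLeffler a b) (Metric.ball 0 (‖z‖ + 1)) := by
    refine continuousOn_tsum (u := fun n => (1 / 2) ^ n *
      Real.exp (1 + (2 * (‖z‖ + 1)) ^ (1 / a))) (fun n => by fun_prop)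
      (summable_geometric_two.mul_right _) fun n y hy => ?_
    refine (norm_mittagLeffler_term_le ha hb y n).trans ?_
    have : ‖y‖ ≤ ‖z‖ + 1 := by
      rw [Metric.mem_ball, dist_zero_right] at hy
      exact hy.le
    gcongr
  exact h.continuousAt (Metric.isOpen_ball.mem_nhds (by simp))

/-- The base case of subordination: for `α < 2`, boundedness and decay of `E_α` are derived from the
cosine. -/
theorem mittagLeffler_two_one (x : ℝ) :
    mittagLeffler 2 1 (-((x ^ (2 : ℝ) : ℝ) : ℂ)) = (Real.cos x : ℂ) := by
  rw [Complex.ofReal_cos]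
  refine (hasSum_mittagLeffler two_pos le_rfl _).unique ?_
  convert Complex.hasSum_cos x using 2 with n
  rw [show (2 * (n : ℝ) + 1) = ((2 * n : ℕ) : ℝ) + 1 by push_cast; ring, Complex.ofReal_add,
    Complex.ofReal_natCast, Complex.ofReal_one, Complex.Gamma_nat_eq_factorial, Real.rpow_two,
    neg_pow, pow_mul]
  push_cast
  rfl

theorem wrightM_eq (γ : ℝ) (z : ℂ) : wrightM γ z = wright (-γ) ((1 - γ : ℝ) : ℂ) (-z) := by
  simp [wrightM]

theorem wrightN_eq (γ : ℝ) (z : ℂ) : wrightN γ z = wright (-γ) ((2 - γ : ℝ) : ℂ) (-z) := by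
  simp [wrightN]

theorem integrableOn_wright {γ : ℝ} (h0 : 0 < γ) (h1 : γ < 1) (μ : ℝ) :
    IntegrableOn (fun ξ : ℝ => wright (-γ) μ (-ξ)) (Ioi 0) := by
  obtain ⟨C, hC, hb⟩ := exists_norm_wright_le h0 h1 μ 1
  refine ((integrableOn_exp_neg_Ioi 0).const_mul C).mono' (aestronglyMeasurable_wright h0 h1 μ _) ?_
  filter_upwards [ae_restrict_mem measurableSet_Ioi] with ξ hξ
  simpa using hb ξ (le_of_lt hξ)

/-- The subordination identity for Mittag-Leffler functions. -/
theorem subordination {α β γ : ℝ} (hα : 0 < α) (hβ : γ * α = β) (h0 : 0 < γ) (h1 : γ < 1)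
    (μ : ℝ) {κ : ℝ} (hκ : 0 ≤ κ) :
    IntegrableOn (fun ξ : ℝ => wright (-γ) μ (-ξ) *
      mittagLeffler α 1 (-(((κ * ξ) ^ α : ℝ) : ℂ))) (Ioi 0) ∧
    mittagLeffler β (μ + γ) (-((κ ^ α : ℝ) : ℂ)) = ∫ ξ in Ioi (0 : ℝ), wright (-γ) μ (-ξ) *
      mittagLeffler α 1 (-(((κ * ξ) ^ α : ℝ) : ℂ)) := by
  -- Chosen so that `(2(κξ)^α)^{1/α} = qξ`. Decay of the Wright function at rate `q + 1` then leaves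
  -- a factor `e^{-ξ}` in every term.
  set q : ℝ := 2 ^ (1 / α) * κ with hq
  obtain ⟨C, hC, hW⟩ := exists_norm_wright_le h0 h1 μ (q + 1)
  have hbound : ∀ n : ℕ, ∀ ξ ∈ Ioi (0 : ℝ), ‖wright (-γ) μ (-ξ) *
      ((-(((κ * ξ) ^ α : ℝ) : ℂ)) ^ n / Complex.Gamma ((α * n + 1 : ℝ) : ℂ))‖ ≤
      (1 / 2) ^ n * (C * Real.exp 1 * Real.exp (-ξ)) := by
    intro n ξ hξ
    have hξ' : 0 ≤ ξ := le_of_lt hξ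
    have h2 := norm_mittagLeffler_term_le hα le_rfl (-(((κ * ξ) ^ α : ℝ) : ℂ)) n
    have h3 : (2 * ‖-(((κ * ξ) ^ α : ℝ) : ℂ)‖) ^ (1 / α) = q * ξ := by
      rw [norm_neg, Complex.norm_real, Real.norm_of_nonneg (by positivity),
        Real.mul_rpow two_pos.le (by positivity), ← Real.rpow_mul (by positivity),
        mul_one_div_cancel hα.ne', Real.rpow_one, hq, mul_assoc]
    rw [h3] at h2
    rw [norm_mul]
    calc _ ≤ (C * Real.exp (-((q + 1) * ξ))) * ((1 / 2) ^ n * Real.exp (1 + q * ξ)) :=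
          mul_le_mul (hW ξ hξ') h2 (norm_nonneg _) (by positivity)
      _ = (1 / 2) ^ n * (C * (Real.exp (-((q + 1) * ξ)) * Real.exp (1 + q * ξ))) := by ring
      _ = (1 / 2) ^ n * (C * (Real.exp 1 * Real.exp (-ξ))) := by
          rw [← Real.exp_add, ← Real.exp_add]
          congr 3
          ring
      _ = _ := by ring
  have hE : Integrable (fun ξ : ℝ => C * Real.exp 1 * Real.exp (-ξ)) (volume.restrict (Ioi 0)) :=
    (integrableOn_exp_neg_Ioi 0).const_mul _
  have hcont : ∀ z : ℝ → ℝ, Measurable z → AEStronglyMeasurable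
      (fun ξ : ℝ => mittagLeffler α 1 (-((z ξ : ℝ) : ℂ))) (volume.restrict (Ioi 0)) := fun z hz =>
    ((continuous_mittagLeffler hα le_rfl).measurable.comp
      (Complex.measurable_ofReal.comp hz).neg).aestronglyMeasurable
  have hsum : ∀ ξ : ℝ, HasSum (fun n : ℕ => wright (-γ) μ (-ξ) *
      ((-(((κ * ξ) ^ α : ℝ) : ℂ)) ^ n / Complex.Gamma ((α * n + 1 : ℝ) : ℂ)))
      (wright (-γ) μ (-ξ) * mittagLeffler α 1 (-(((κ * ξ) ^ α : ℝ) : ℂ))) := fun ξ =>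
    (hasSum_mittagLeffler hα le_rfl _).mul_left _
  have hgeom : ∀ x : ℝ, HasSum (fun n : ℕ => (1 / 2) ^ n * x) (2 * x) := fun x =>
    hasSum_geometric_two.mul_right x
  refine ⟨(hE.const_mul 2).mono' ((aestronglyMeasurable_wright h0 h1 μ _).mul
    (hcont _ (by fun_prop))) ?_, ?_⟩
  · filter_upwards [ae_restrict_mem measurableSet_Ioi] with ξ hξ
    exact (hsum ξ).norm_le_of_bounded (hgeom _) fun n => hbound n ξ hξ
  have hI := hasSum_integral_of_dominated_convergence (μ := volume.restrict (Ioi 0))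
    (fun (n : ℕ) ξ => (1 / 2) ^ n * (C * Real.exp 1 * Real.exp (-ξ)))
    (fun n => (aestronglyMeasurable_wright h0 h1 μ _).mul
      (Measurable.aestronglyMeasurable (by fun_prop)))
    (fun n => (ae_restrict_mem measurableSet_Ioi).mono fun ξ hξ => hbound n ξ hξ)
    (Eventually.of_forall fun ξ => (hgeom _).summable)
    (by simp_rw [(hgeom _).tsum_eq]; exact hE.const_mul 2)
    (Eventually.of_forall hsum)
  rw [← hI.tsum_eq, mittagLeffler]
  refine tsum_congr fun n => ?_
  have h2 : ∀ ξ ∈ Ioi (0 : ℝ), wright (-γ) μ (-ξ) *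
      ((-(((κ * ξ) ^ α : ℝ) : ℂ)) ^ n / Complex.Gamma ((α * n + 1 : ℝ) : ℂ)) =
      (-((κ ^ α : ℝ) : ℂ)) ^ n / Complex.Gamma ((α * n + 1 : ℝ) : ℂ) *
        (wright (-γ) μ (-ξ) * ((ξ ^ (α * n) : ℝ) : ℂ)) := by
    intro ξ hξ
    rw [Real.mul_rpow hκ (le_of_lt hξ), Real.rpow_mul (le_of_lt hξ), Real.rpow_natCast]
    push_cast
    rw [← neg_mul, mul_pow]
    ring
  have hn : 0 ≤ α * n := by positivity
  have hG := Real.Gamma_pos_of_pos (show 0 < α * n + 1 by linarith)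
  have hG' : (Real.Gamma (α * n + 1) : ℂ) ≠ 0 := by exact_mod_cast hG.ne'
  refine Eq.trans ?_ (setIntegral_congr_fun measurableSet_Ioi h2).symm
  -- The moment with `s = αn` cancels `Γ(αn+1)`, and `γα = β` identifies the remaining Gamma
  -- argument.
  rw [integral_const_mul,
    integral_wright_mul_rpow h0 h1 μ hn, Complex.Gamma_ofReal, Complex.Gamma_ofReal,
    show μ + γ * (α * n + 1) = β * n + (μ + γ) by rw [← hβ]; ring, Complex.ofReal_div,
    div_mul_div_cancel₀ hG']

/-! ### Boundedness and decay on the negative axis -/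

theorem exists_norm_mittagLeffler_one_le {α : ℝ} (hα : 0 < α) (hα2 : α ≤ 2) :
    ∃ C : ℝ, 0 ≤ C ∧ ∀ x : ℝ, 0 ≤ x → ‖mittagLeffler α 1 (-(x : ℂ))‖ ≤ C := by
  have hsq : ∀ x : ℝ, 0 ≤ x → x = (√x) ^ (2 : ℝ) := fun x hx => by
    rw [Real.rpow_two, Real.sq_sqrt hx]
  have hcos : ∀ x : ℝ, ‖(Real.cos x : ℂ)‖ ≤ 1 := fun x => by
    rw [Complex.norm_real]
    exact Real.abs_cos_le_one x
  rcases hα2.lt_or_eq with h | rfl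
  · have h0 : 0 < α / 2 := by linarith
    have h1 : α / 2 < 1 := by linarith
    refine ⟨∫ ξ in Ioi (0 : ℝ), ‖wright (-(α / 2)) ((1 - α / 2 : ℝ) : ℂ) (-ξ)‖,
      integral_nonneg fun _ => norm_nonneg _, fun x hx => ?_⟩
    have h2 := (subordination two_pos (by ring : α / 2 * 2 = α) h0 h1 (1 - α / 2)
      (Real.sqrt_nonneg x)).2
    rw [sub_add_cancel, ← hsq x hx] at h2
    rw [h2]
    refine norm_integral_le_of_norm_le (integrableOn_wright h0 h1 _).norm
      (Eventually.of_forall fun ξ => ?_)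
    rw [mittagLeffler_two_one, norm_mul]
    exact mul_le_of_le_one_right (norm_nonneg _) (hcos _)
  · refine ⟨1, zero_le_one, fun x hx => ?_⟩
    rw [hsq x hx, mittagLeffler_two_one]
    exact hcos _

/-- Subordination integrates a bounded function against an integrable one. This also covers the
second parameter `2` when `μ = 2 - γ`. -/
theorem exists_norm_mittagLeffler_le {α β γ : ℝ} (hα : 0 < α) (hα2 : α ≤ 2) (hβ : γ * α = β)
    (h0 : 0 < γ) (h1 : γ < 1) (μ : ℝ) :
    ∃ C : ℝ, 0 ≤ C ∧ ∀ κ : ℝ, 0 ≤ κ → ‖mittagLeffler β (μ + γ) (-((κ ^ α : ℝ) : ℂ))‖ ≤ C := by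
  obtain ⟨C, hC, hb⟩ := exists_norm_mittagLeffler_one_le hα hα2
  refine ⟨∫ ξ in Ioi (0 : ℝ), ‖wright (-γ) μ (-ξ)‖ * C,
    integral_nonneg fun _ => by positivity, fun κ hκ => ?_⟩
  rw [(subordination hα hβ h0 h1 μ hκ).2]
  refine norm_integral_le_of_norm_le ((integrableOn_wright h0 h1 μ).norm.mul_const C) ?_
  filter_upwards [ae_restrict_mem measurableSet_Ioi] with ξ hξ
  rw [norm_mul]
  have hξ' : 0 ≤ ξ := le_of_lt hξ
  exact mul_le_mul_of_nonneg_left (hb _ (by positivity)) (norm_nonneg _)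

/-- `∫₀^∞ cos(v t) e^(-s t) dt = s / (s² + v²)`. -/
theorem integral_cos_mul_cexp_neg_mul_Ioi {s : ℂ} (hs : 0 < s.re) (v : ℝ) :
    ∫ t in Ioi (0 : ℝ), (Real.cos (v * t) : ℂ) * Complex.exp (-(s * t)) =
      s / (s ^ 2 + v ^ 2) := by
  have hI : ∀ z : ℂ, 0 < z.re → IntegrableOn (fun t : ℝ => Complex.exp (-(z * t))) (Ioi 0) := by
    intro z hz
    have := integrableOn_exp_mul_complex_Ioi (a := -z) (by simpa using hz) 0
    simpa only [neg_mul] using this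
  have hv : ∀ z : ℂ, 0 < z.re → ∫ t in Ioi (0 : ℝ), Complex.exp (-(z * t)) = z⁻¹ := by
    intro z hz
    have := integral_rpow_mul_cexp_neg_mul_Ioi one_pos hz
    simpa [Complex.cpow_neg_one] using this
  have h1 : 0 < (s - v * Complex.I).re := by simpa using hs
  have h2 : 0 < (s + v * Complex.I).re := by simpa using hs
  have e : ∀ t : ℝ, (Real.cos (v * t) : ℂ) * Complex.exp (-(s * t)) =
      2⁻¹ * (Complex.exp (-((s - v * Complex.I) * t)) +
        Complex.exp (-((s + v * Complex.I) * t))) := by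
    intro t
    rw [Complex.ofReal_cos, Complex.cos, show -((s - v * Complex.I) * t) =
      (v * t : ℝ) * Complex.I + -(s * t) by push_cast; ring,
      show -((s + v * Complex.I) * t) = -((v * t : ℝ) : ℂ) * Complex.I + -(s * t) by
        push_cast; ring, Complex.exp_add, Complex.exp_add]
    ring
  simp_rw [e]
  rw [integral_const_mul, integral_add (hI _ h1) (hI _ h2), hv _ h1, hv _ h2]
  have n1 : s - v * Complex.I ≠ 0 := fun h => by rw [h] at h1; simp at h1
  have n2 : s + v * Complex.I ≠ 0 := fun h => by rw [h] at h2; simp at h2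
  have n3 : s ^ 2 + (v : ℂ) ^ 2 = (s - v * Complex.I) * (s + v * Complex.I) := by
    linear_combination (v : ℂ) ^ 2 * Complex.I_sq
  rw [n3]
  field_simp
  ring

/-- Compare `‖s² + u‖² = (‖s‖² - u)² + 4u (Re s)²` with `(‖s‖² + u)² = (‖s‖² - u)² + 4u ‖s‖²`. -/
theorem mul_le_norm_sq_add {η u : ℝ} {s : ℂ} (h0 : 0 ≤ η) (h1 : η ≤ 1) (hu : 0 ≤ u)
    (hs : η * ‖s‖ ≤ s.re) : η * (‖s‖ ^ 2 + u) ≤ ‖s ^ 2 + u‖ := by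
  refine abs_le_of_sq_le_sq' ?_ (norm_nonneg _) |>.2
  have h2 : (η * ‖s‖) ^ 2 ≤ s.re ^ 2 := pow_le_pow_left₀ (by positivity) hs 2
  have h3 : ‖s‖ ^ 2 = s.re ^ 2 + s.im ^ 2 := by
    rw [Complex.sq_norm, Complex.normSq_apply]
    ring
  have h4 : ‖s ^ 2 + u‖ ^ 2 = (‖s‖ ^ 2 - u) ^ 2 + 4 * u * s.re ^ 2 := by
    rw [Complex.sq_norm, Complex.normSq_apply, h3]
    simp only [Complex.add_re, Complex.add_im, Complex.ofReal_re, Complex.ofReal_im, pow_two,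
      Complex.mul_re, Complex.mul_im]
    ring
  have h5 : η ^ 2 ≤ 1 := pow_le_one₀ h0 h1
  rw [h4]
  nlinarith [mul_le_mul_of_nonneg_left h2 hu,
    mul_le_mul_of_nonneg_right h5 (sq_nonneg (‖s‖ ^ 2 - u))]

/-- `E_α(-u)` for `α < 2` decays like `1 / u` and its derivative like `1 / u²`. -/
theorem exists_mittagLeffler_decay {α : ℝ} (hα : 0 < α) (hα2 : α < 2) :
    ∃ (e e' : ℝ → ℝ) (C δ : ℝ), 0 ≤ C ∧ 0 < δ ∧
      (∀ u : ℝ, 0 ≤ u → mittagLeffler α 1 (-(u : ℂ)) = e u) ∧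
      (∀ u, 0 < u → HasDerivAt e (e' u) u) ∧
      (∀ u, 0 ≤ u → |e u| ≤ C / (δ + u)) ∧
      (∀ u, 0 < u → |e' u| ≤ C / (δ + u) ^ 2) := by
  -- Subordinate to the cosine with `γ = α/2`. Its Laplace transform at `S = σ^γ` is `S/(S² + u)`,
  -- which gives `E_α(-u) = (1/2πi) ∫ e^σ σ^{α-1}/(σ^α + u) dσ`. The sector bound keeps the
  -- denominator at least `η(m² + u)`.
  obtain ⟨γ, hγα⟩ : ∃ γ : ℝ, γ * 2 = α := ⟨α / 2, by ring⟩
  have h0 : 0 < γ := by linarith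
  have h1 : γ < 1 := by linarith
  obtain ⟨w, hw, hγ⟩ := exists_contourDir h0 h1
  set η : ℝ := Real.cos (w.arg * γ) with hη
  have hη0 : 0 < η := hw.cos_pos h0 hγ
  have hη1 : η ≤ 1 := Real.cos_le_one _
  have him := hw.im_pos
  set m : ℝ := η * (1 * w.im) ^ γ with hm
  have hm0 : 0 < m := by positivity
  set S : ℝ → ℂ := fun r => ray 1 w r ^ (γ : ℂ) with hS
  have hSm : ∀ r, 0 ≤ r → m ≤ (S r).re := fun r hr => hw.apex_le_re_cpow one_pos h0 hγ hr
  have hSη : ∀ r, 0 ≤ r → η * ‖S r‖ ≤ (S r).re := fun r hr => by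
    rw [hS, Complex.norm_cpow_real]
    exact hw.cos_mul_le_re_cpow one_pos h0 hγ hr
  have hden : ∀ r u : ℝ, 0 ≤ r → 0 ≤ u → η * (m ^ 2 + u) ≤ ‖S r ^ 2 + u‖ := fun r u hr hu => by
    refine le_trans ?_ (mul_le_norm_sq_add hη0.le hη1 hu (hSη r hr))
    have h3 : m ≤ ‖S r‖ := (hSm r hr).trans (Complex.re_le_norm _)
    have := pow_le_pow_left₀ hm0.le h3 2
    exact mul_le_mul_of_nonneg_left (by linarith) hη0.le
  have hden0 : ∀ r u : ℝ, 0 ≤ r → 0 ≤ u → S r ^ 2 + u ≠ 0 := fun r u hr hu h => by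
    have := hden r u hr hu
    rw [h, norm_zero] at this
    have : 0 < η * (m ^ 2 + u) := by positivity
    linarith
  set A : ℝ → ℂ := fun r => Complex.exp (ray 1 w r) * (ray 1 w r ^ ((-(1 - γ) : ℝ) : ℂ) * S r)
    with hA
  have hA' : ∀ r ∈ Ioi (0 : ℝ), A r = Complex.exp (ray 1 w r) * ray 1 w r ^ ((α - 1 : ℝ) : ℂ) := by
    intro r hr
    rw [hA, hS]
    simp only
    rw [← Complex.cpow_add _ _ (hw.ray_ne_zero one_pos (le_of_lt hr)), ← hγα]
    congr 2
    push_cast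
    ring
  have hAint : IntegrableOn A (Ioi 0) :=
    (hw.integrableOn_exp_mul_cpow one_pos (α - 1)).congr_fun (fun r hr => (hA' r hr).symm)
      measurableSet_Ioi
  have hSmeas : Measurable S := (continuous_ray 1 w).measurable.pow_const _
  set B : ℝ := ∫ r in Ioi (0 : ℝ), ‖A r‖ with hB
  have hB0 : 0 ≤ B := integral_nonneg fun _ => norm_nonneg _
  have hpi := Real.pi_pos
  have hmeas : ∀ (u : ℝ) (n : ℕ), AEStronglyMeasurable
      (fun r => A r / (S r ^ 2 + u) ^ n) (volume.restrict (Ioi 0)) := fun u n =>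
    hAint.aestronglyMeasurable.mul
      (((hSmeas.pow_const 2).add_const _).pow_const n).inv.aestronglyMeasurable
  have hle : ∀ (n : ℕ) (u r : ℝ), 0 ≤ u → r ∈ Ioi (0 : ℝ) →
      ‖A r / (S r ^ 2 + u) ^ n‖ ≤ (1 / (η * (m ^ 2 + u)) ^ n) * ‖A r‖ := fun n u r hu hr => by
    rw [norm_div, norm_pow, div_mul_eq_mul_div, one_mul]
    have h4 : 0 < η * (m ^ 2 + u) := by positivity
    exact div_le_div_of_nonneg_left (norm_nonneg _) (by positivity)
      (pow_le_pow_left₀ h4.le (hden r u (le_of_lt hr) hu) n)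
  have hint : ∀ (n : ℕ) (u : ℝ), 0 ≤ u →
      IntegrableOn (fun r => A r / (S r ^ 2 + u) ^ n) (Ioi 0) := fun n u hu =>
    (hAint.norm.const_mul _).mono' (hmeas u n)
      ((ae_restrict_mem measurableSet_Ioi).mono fun r hr => hle n u r hu hr)
  have hnorm : ∀ (n : ℕ) (u : ℝ), 0 ≤ u →
      |Real.pi⁻¹ * ((∫ r in Ioi (0 : ℝ), A r / (S r ^ 2 + u) ^ n) * w).im| ≤
        Real.pi⁻¹ * ((1 / (η * (m ^ 2 + u)) ^ n) * B) := fun n u hu => by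
    rw [abs_mul, abs_of_nonneg (inv_nonneg.2 hpi.le)]
    refine mul_le_mul_of_nonneg_left ((Complex.abs_im_le_norm _).trans ?_) (inv_nonneg.2 hpi.le)
    rw [norm_mul, hw.norm_eq, mul_one, hB, ← integral_const_mul]
    exact norm_integral_le_of_norm_le (hAint.norm.const_mul _)
      ((ae_restrict_mem measurableSet_Ioi).mono fun r hr => hle n u r hu hr)
  refine ⟨fun u => Real.pi⁻¹ * ((∫ r in Ioi (0 : ℝ), A r / (S r ^ 2 + u) ^ 1) * w).im,
    fun u => -(Real.pi⁻¹ * ((∫ r in Ioi (0 : ℝ), A r / (S r ^ 2 + u) ^ 2) * w).im),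
    -- The derivative bound needs `η²`; as `η ≤ 1`, the same constant serves for the function.
    Real.pi⁻¹ * B / η ^ 2, m ^ 2, by positivity, by positivity, ?_, ?_, ?_, ?_⟩
  · intro u hu
    have hsq : u = (√u) ^ (2 : ℝ) := by rw [Real.rpow_two, Real.sq_sqrt hu]
    have h2 := (subordination two_pos hγα h0 h1 (1 - γ) (Real.sqrt_nonneg u)).2
    rw [sub_add_cancel, ← hsq] at h2
    rw [h2]
    simp_rw [mittagLeffler_two_one]
    have hf : IntegrableOn (fun ξ => Real.exp (-(m * ξ)) * Real.cos (√u * ξ)) (Ioi 0) := by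
      refine (exp_neg_integrableOn_Ioi 0 hm0).mono'
        (Measurable.aestronglyMeasurable (by fun_prop)) (Eventually.of_forall fun ξ => ?_)
      rw [norm_mul, Real.norm_of_nonneg (Real.exp_pos _).le, neg_mul]
      exact mul_le_of_le_one_right (Real.exp_pos _).le (Real.abs_cos_le_one _)
    rw [hw.integral_wright_mul one_pos h1 hSm hf, contourIntegral]
    congr 4
    refine setIntegral_congr_fun measurableSet_Ioi fun r hr => ?_
    have h5 : 0 < (S r).re := hm0.trans_le (hSm r (le_of_lt hr))
    rw [integral_cos_mul_cexp_neg_mul_Ioi h5, ← Complex.ofReal_pow, Real.sq_sqrt hu, pow_one, hA]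
    simp only
    ring
  · intro u hu
    have key := (hasDerivAt_integral_of_dominated_loc_of_deriv_le (μ := volume.restrict (Ioi 0))
      (F := fun (u : ℝ) r => A r / (S r ^ 2 + u) ^ 1)
      (F' := fun (u : ℝ) r => -(A r / (S r ^ 2 + u) ^ 2))
      (bound := fun r => (1 / (η * (m ^ 2 + 0)) ^ 2) * ‖A r‖)
      (x₀ := u) (Ioi_mem_nhds hu) (Eventually.of_forall fun u => hmeas u 1) (hint 1 u hu.le)
      (hmeas u 2).neg ?_ (hAint.norm.const_mul _) ?_).2
    · rw [integral_neg] at key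
      have k2 := (Complex.imCLM.hasFDerivAt.comp_hasDerivAt u (key.mul_const w)).const_mul
        Real.pi⁻¹
      rw [neg_mul, map_neg, mul_neg] at k2
      exact k2
    · filter_upwards [ae_restrict_mem measurableSet_Ioi] with r hr x hx
      have hx0 : 0 ≤ x := le_of_lt hx
      rw [norm_neg]
      refine (hle 2 x r hx0 hr).trans (mul_le_mul_of_nonneg_right ?_ (norm_nonneg _))
      gcongr
    · filter_upwards [ae_restrict_mem measurableSet_Ioi] with r hr x hx
      have hne := hden0 r x (le_of_lt hr) (le_of_lt hx)
      have h6 : HasDerivAt (fun x : ℝ => S r ^ 2 + (x : ℂ)) 1 x :=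
        (Complex.ofRealCLM.hasDerivAt (x := x)).const_add (S r ^ 2)
      simp only [pow_one]
      convert! (h6.inv hne).const_mul (A r) using 1
      field_simp
  · intro u hu
    refine (hnorm 1 u hu).trans ?_
    rw [pow_one, show Real.pi⁻¹ * (1 / (η * (m ^ 2 + u)) * B) =
      Real.pi⁻¹ * B / (η * (m ^ 2 + u)) by ring, div_div]
    refine div_le_div_of_nonneg_left (by positivity) (by positivity) ?_
    refine mul_le_mul_of_nonneg_right ?_ (by positivity)
    nlinarith
  · intro u hu
    rw [abs_neg]
    refine (hnorm 2 u hu.le).trans (le_of_eq ?_)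
    rw [mul_pow]
    field_simp

/-! ### Symbols and Mellin convolution of tempered distributions -/

theorem symbolG_one (β α k : ℝ) :
    symbolG β α 1 k = mittagLeffler β 1 (-((|k| ^ α : ℝ) : ℂ)) := by
  simp [symbolG]

theorem symbolH_one (β α k : ℝ) :
    symbolH β α 1 k = mittagLeffler β 2 (-((|k| ^ α : ℝ) : ℂ)) := by
  simp [symbolH]

theorem continuous_mittagLeffler_abs_rpow {a b α : ℝ} (ha : 0 < a) (hb : 1 ≤ b) (hα : 0 < α) :
    Continuous fun k : ℝ => mittagLeffler a b (-((|k| ^ α : ℝ) : ℂ)) :=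
  (continuous_mittagLeffler ha hb).comp (Complex.continuous_ofReal.comp
    (continuous_abs.rpow_const fun _ => Or.inr hα.le)).neg

theorem boundedSymbol_of_continuous {g : ℝ → ℂ} (hg : Continuous g) {C : ℝ}
    (hC : ∀ k, ‖g k‖ ≤ C) : BoundedSymbol g :=
  memLp_top_of_bound (hg.comp (by fun_prop)).aestronglyMeasurable C
    (Eventually.of_forall fun _ => hC _)

theorem invFourier_apply_eq {g : ℝ → ℂ} (h : BoundedSymbol g) (φ : 𝓢(ℝ, ℂ)) :
    invFourier g φ = ∫ ν : ℝ, (𝓕⁻ φ) ν * g (2 * Real.pi * ν) := by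
  rw [invFourier, dif_pos h, TemperedDistribution.fourierInv_apply,
    Lp.toTemperedDistribution_apply]
  refine integral_congr_ae ?_
  filter_upwards [MemLp.coeFn_toLp h] with ν hν
  rw [hν, smul_eq_mul]

theorem fourierInv_dilate {ξ : ℝ} (hξ : 0 < ξ) (φ : 𝓢(ℝ, ℂ)) (ν : ℝ) :
    (𝓕⁻ (dilate ξ φ)) ν = (ξ⁻¹ : ℝ) • (𝓕⁻ φ) (ξ⁻¹ * ν) := by
  rw [SchwartzMap.fourierInv_coe, SchwartzMap.fourierInv_coe, Real.fourierInv_eq',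
    Real.fourierInv_eq']
  have := Measure.integral_comp_mul_left
    (fun x : ℝ => Complex.exp (↑(2 * Real.pi * inner ℝ x (ξ⁻¹ * ν)) * Complex.I) • φ x) ξ
  rw [abs_of_pos (inv_pos.2 hξ)] at this
  rw [← this]
  refine integral_congr_ae (Eventually.of_forall fun x => ?_)
  simp only [dilate_apply hξ.ne']
  congr 4
  simp
  field_simp

/-- The Fourier transform of `T(·/ξ)` is `ξ g(ξk)`. The dilation thus passes to the symbol, and `ξ`
cancels the `1/ξ` of the Mellin convolution. -/
theorem rescaledPairing_invFourier {g : ℝ → ℂ} (h : BoundedSymbol g) {ξ : ℝ} (hξ : 0 < ξ)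
    (φ : 𝓢(ℝ, ℂ)) :
    rescaledPairing (invFourier g) ξ φ =
      ξ * ∫ ν : ℝ, (𝓕⁻ φ) ν * g (2 * Real.pi * (ξ * ν)) := by
  rw [rescaledPairing, invFourier_apply_eq h]
  congr 1
  have := Measure.integral_comp_mul_left
    (fun ν : ℝ => (𝓕⁻ φ) ν * g (2 * Real.pi * (ξ * ν))) ξ⁻¹
  rw [inv_inv, abs_of_pos hξ] at this
  rw [← inv_smul_eq_iff₀ hξ.ne'] at this
  rw [← this, ← integral_smul]
  refine integral_congr_ae (Eventually.of_forall fun ν => ?_)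
  simp only [fourierInv_dilate hξ, mul_inv_cancel_left₀ hξ.ne', smul_mul_assoc]

/-- A symbol that is a subordinated integral has a Mellin convolution as inverse transform. -/
theorem isMellinConvolution_invFourier {m : ℝ → ℂ} {g h : ℝ → ℂ} (hg : Continuous g)
    (hm : IntegrableOn m (Ioi 0)) {C : ℝ} (hC : ∀ k, ‖g k‖ ≤ C) (hh : BoundedSymbol h)
    (hsub : ∀ k, h k = ∫ ξ in Ioi (0 : ℝ), m ξ * g (ξ * k)) :
    IsMellinConvolution m (invFourier g) (invFourier h) := by
  intro φ
  have hgb := boundedSymbol_of_continuous hg hC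
  set ψ : 𝓢(ℝ, ℂ) := 𝓕⁻ φ with hψ
  -- Fubini's hypothesis: `m` and `ψ` are integrable in separate variables and `g` is bounded.
  have hint : Integrable (Function.uncurry fun ξ ν : ℝ =>
      m ξ * (ψ ν * g (2 * Real.pi * (ξ * ν)))) ((volume.restrict (Ioi 0)).prod volume) := by
    have h1 := (hm.mul_prod (ψ.integrable (μ := volume)))
    have h2 : AEStronglyMeasurable (fun p : ℝ × ℝ => g (2 * Real.pi * (p.1 * p.2)))
        ((volume.restrict (Ioi 0)).prod volume) :=
      (hg.comp (by fun_prop)).aestronglyMeasurable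
    refine (h1.mul_bdd (c := C) h2 (Eventually.of_forall fun p => hC _)).congr
      (Eventually.of_forall fun p => ?_)
    simp only [Function.uncurry]
    ring
  have e1 : ∀ ξ ∈ Ioi (0 : ℝ), m ξ * rescaledPairing (invFourier g) ξ φ / ξ =
      ∫ ν : ℝ, m ξ * (ψ ν * g (2 * Real.pi * (ξ * ν))) := by
    intro ξ hξ
    have hξ0 : (ξ : ℂ) ≠ 0 := by exact_mod_cast (ne_of_gt hξ)
    rw [rescaledPairing_invFourier hgb hξ, integral_const_mul]
    field_simp
    rfl
  refine ⟨?_, ?_⟩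
  · exact (integrableOn_congr_fun e1 measurableSet_Ioi).2 hint.integral_prod_left
  · rw [setIntegral_congr_fun measurableSet_Ioi e1, integral_integral_swap hint,
      invFourier_apply_eq hh]
    refine integral_congr_ae (Eventually.of_forall fun ν => ?_)
    simp only
    rw [hsub, ← integral_const_mul]
    refine integral_congr_ae (Eventually.of_forall fun ξ => ?_)
    simp only
    rw [mul_left_comm, show ξ * (2 * Real.pi * ν) = 2 * Real.pi * (ξ * ν) by ring]

/-! ### Improper inverse Fourier integrals and pointwise formulas -/

/-- Dirichlet's test for cosine integrals of functions with integrable derivative. -/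
theorem exists_cos_integral_bound {E E' : ℝ → ℝ} (hE : ContinuousOn E (Ici 0))
    (hd : ∀ k, 0 < k → HasDerivAt E (E' k) k) (hi : IntegrableOn E' (Ioi 0)) {B : ℝ}
    (hB : ∀ k, 0 ≤ k → |E k| ≤ B) (h0 : Tendsto E atTop (𝓝 0)) :
    ∃ C : ℝ, ∀ y : ℝ, y ≠ 0 →
      (∀ S : ℝ, 0 ≤ S → |∫ k in (0 : ℝ)..S, E k * Real.cos (k * y)| ≤ C / |y|) ∧
      ∃ l : ℝ, Tendsto (fun S => ∫ k in (0 : ℝ)..S, E k * Real.cos (k * y)) atTop (𝓝 l) := by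
  -- Integrate by parts with the primitive `sin(ky)/y`, bounded by `1/|y|`: the boundary term
  -- contributes `B`, the rest the total variation of `E`.
  refine ⟨B + ∫ k in Ioi (0 : ℝ), |E' k|, fun y hy => ?_⟩
  have hsin : ∀ k : ℝ, |Real.sin (k * y) / y| ≤ 1 / |y| := fun k => by
    rw [abs_div]
    exact div_le_div_of_nonneg_right (Real.abs_sin_le_one _) (abs_nonneg _)
  have hint : IntegrableOn (fun k => E' k * (Real.sin (k * y) / y)) (Ioi 0) := by
    refine hi.mul_bdd (c := 1 / |y|) (Continuous.aestronglyMeasurable (by fun_prop))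
      (Eventually.of_forall hsin)
  have hparts : ∀ S : ℝ, 0 ≤ S → ∫ k in (0 : ℝ)..S, E k * Real.cos (k * y) =
      E S * (Real.sin (S * y) / y) - ∫ k in (0 : ℝ)..S, E' k * (Real.sin (k * y) / y) := by
    intro S hS
    have hv : ∀ k : ℝ, HasDerivAt (fun k => Real.sin (k * y) / y) (Real.cos (k * y)) k := by
      intro k
      have h2 : HasDerivAt (fun k : ℝ => k * y) y k := by
        simpa using (hasDerivAt_id k).mul_const y
      convert! h2.sin.div_const y using 1
      field_simp
    have := intervalIntegral.integral_mul_deriv_eq_deriv_mul_of_hasDeriv_right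
      (a := 0) (b := S) (u := E) (u' := E') (v := fun k => Real.sin (k * y) / y)
      (v' := fun k => Real.cos (k * y)) ?_ (Continuous.continuousOn (by fun_prop)) ?_
      (fun k _ => (hv k).hasDerivWithinAt) ?_
      (Continuous.intervalIntegrable (by fun_prop) _ _)
    · rw [this]
      simp
    · rw [uIcc_of_le hS]
      exact hE.mono Icc_subset_Ici_self
    · intro k hk
      rw [min_eq_left hS] at hk
      exact (hd k hk.1).hasDerivWithinAt
    · rw [intervalIntegrable_iff_integrableOn_Ioc_of_le hS]
      exact hi.mono_set Ioc_subset_Ioi_self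
  refine ⟨fun S hS => ?_, ?_⟩
  · rw [hparts S hS, add_div]
    refine (abs_sub _ _).trans (add_le_add ?_ ?_)
    · rw [abs_mul, div_eq_mul_one_div B]
      exact mul_le_mul (hB S hS) (hsin S) (abs_nonneg _) ((abs_nonneg _).trans (hB S hS))
    · rw [intervalIntegral.integral_of_le hS, div_eq_mul_one_div, ← integral_mul_const]
      have hI : IntegrableOn (fun k => |E' k| * (1 / |y|)) (Ioi 0) := hi.norm.mul_const _
      have h3 : ∀ k, ‖E' k * (Real.sin (k * y) / y)‖ ≤ |E' k| * (1 / |y|) := fun k => by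
        rw [norm_mul]
        exact mul_le_mul_of_nonneg_left (hsin k) (norm_nonneg _)
      refine (norm_integral_le_of_norm_le (hI.mono_set Ioc_subset_Ioi_self)
        (Eventually.of_forall h3)).trans ?_
      exact setIntegral_mono_set hI
        (Eventually.of_forall fun k => by simp only [Pi.zero_apply]; positivity)
        Ioc_subset_Ioi_self.eventuallyLE
  · refine ⟨0 - ∫ k in Ioi (0 : ℝ), E' k * (Real.sin (k * y) / y), ?_⟩
    have h4 : Tendsto (fun S => E S * (Real.sin (S * y) / y)) atTop (𝓝 0) := by
      refine squeeze_zero_norm (fun S => ?_)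
        (by simpa only [norm_zero, zero_mul] using h0.norm.mul_const (1 / |y|))
      rw [norm_mul]
      exact mul_le_mul_of_nonneg_left (hsin S) (norm_nonneg _)
    refine (h4.sub (intervalIntegral_tendsto_integral_Ioi 0 hint tendsto_id)).congr' ?_
    filter_upwards [eventually_ge_atTop 0] with S hS using (hparts S hS).symm

theorem truncInvFourier_of_even {g : ℝ → ℂ} (hg : Continuous g) (he : ∀ k, g (-k) = g k)
    (x R : ℝ) : truncInvFourier g x R =
      (Real.pi : ℂ)⁻¹ * ∫ k in (0 : ℝ)..R, g k * (Real.cos (k * x) : ℂ) := by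
  have hc : Continuous fun k : ℝ => Complex.exp (Complex.I * k * x) * g k := by fun_prop
  have h1 : ∫ k in (-R)..(0 : ℝ), Complex.exp (Complex.I * k * x) * g k =
      ∫ k in (0 : ℝ)..R, Complex.exp (Complex.I * ((-k : ℝ) : ℂ) * x) * g (-k) := by
    rw [intervalIntegral.integral_comp_neg fun k : ℝ => Complex.exp (Complex.I * k * x) * g k,
      neg_zero]
  have hc' : Continuous fun k : ℝ => Complex.exp (Complex.I * ((-k : ℝ) : ℂ) * x) * g (-k) :=
    hc.comp continuous_neg
  rw [truncInvFourier, ← intervalIntegral.integral_add_adjacent_intervals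
    (hc.intervalIntegrable (-R) 0) (hc.intervalIntegrable 0 R), h1,
    ← intervalIntegral.integral_add (hc'.intervalIntegrable 0 R) (hc.intervalIntegrable 0 R),
    mul_inv, mul_assoc, mul_left_comm, ← intervalIntegral.integral_const_mul]
  congr 1
  refine intervalIntegral.integral_congr fun k _ => ?_
  rw [he, Complex.ofReal_cos, Complex.cos, show Complex.I * ((-k : ℝ) : ℂ) * x =
    -((k * x : ℝ) : ℂ) * Complex.I by push_cast; ring,
    show Complex.I * k * x = ((k * x : ℝ) : ℂ) * Complex.I by push_cast; ring]
  ring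

/-- Uniform control of the truncated inverse Fourier integrals of `E_α(-|k|^α)`. -/
theorem exists_truncInvFourier_bound {α : ℝ} (hα : 0 < α) (hα2 : α < 2) :
    ∃ C : ℝ, ∀ y : ℝ, y ≠ 0 →
      (∀ S : ℝ, 0 ≤ S → ‖truncInvFourier (symbolG α α 1) y S‖ ≤ C / |y|) ∧
      InvFourierConvergesAt (symbolG α α 1) y := by
  obtain ⟨e, e', C, δ, hC, hδ, hee, hd, hb, hb'⟩ := exists_mittagLeffler_decay hα hα2
  have hcont : Continuous (symbolG α α 1) := by
    have := continuous_mittagLeffler_abs_rpow hα le_rfl hα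
    exact this.congr fun k => (symbolG_one α α k).symm
  have hE : ∀ k : ℝ, 0 ≤ k → symbolG α α 1 k = (e (k ^ α) : ℂ) := fun k hk => by
    rw [symbolG_one, abs_of_nonneg hk, hee _ (by positivity)]
  have hEc : ContinuousOn (fun k : ℝ => e (k ^ α)) (Ici 0) := by
    refine (Complex.continuous_re.comp hcont).continuousOn.congr fun k hk => ?_
    rw [Function.comp_apply, hE k hk, Complex.ofReal_re]
  have hEd : ∀ k : ℝ, 0 < k → HasDerivAt (fun k : ℝ => e (k ^ α))
      (e' (k ^ α) * (α * k ^ (α - 1))) k := fun k hk =>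
    (hd _ (by positivity)).comp k (Real.hasDerivAt_rpow_const (Or.inl hk.ne'))
  -- This majorant is the derivative of the increasing bounded function `-C/(δ + k^α)`, hence
  -- integrable even where `k^{α-1}` blows up at `0`.
  have hG : IntegrableOn (fun k : ℝ => C / (δ + k ^ α) ^ 2 * (α * k ^ (α - 1))) (Ioi 0) := by
    refine integrableOn_Ioi_deriv_of_nonneg (g := fun k : ℝ => -(C / (δ + k ^ α))) (l := -0)
      ?_ ?_ ?_ ?_
    · refine (ContinuousAt.neg (ContinuousAt.div continuousAt_const (continuousAt_const.add
        (Real.continuousAt_rpow_const _ _ (Or.inr hα.le))) ?_)).continuousWithinAt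
      simp [Real.zero_rpow hα.ne', hδ.ne']
    · intro k hk
      have hk' : 0 < k := hk
      have hne : δ + k ^ α ≠ 0 := by positivity
      have h1 := ((Real.hasDerivAt_rpow_const (p := α) (Or.inl hk'.ne')).const_add δ)
      convert! ((h1.inv hne).const_mul C).neg using 1
      field_simp
    · intro k hk
      have hk' : 0 < k := hk
      positivity
    · refine Tendsto.neg (Tendsto.div_atTop tendsto_const_nhds
        (tendsto_atTop_add_const_left _ _ (tendsto_rpow_atTop hα)))
  have hi : IntegrableOn (fun k : ℝ => e' (k ^ α) * (α * k ^ (α - 1))) (Ioi 0) := by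
    refine hG.mono' ?_ ?_
    · have hm : AEStronglyMeasurable (deriv fun k : ℝ => e (k ^ α)) (volume.restrict (Ioi 0)) :=
        (measurable_deriv _).aestronglyMeasurable
      refine hm.congr ?_
      filter_upwards [ae_restrict_mem measurableSet_Ioi] with k hk using (hEd k hk).deriv
    · filter_upwards [ae_restrict_mem measurableSet_Ioi] with k hk
      have hk' : 0 < k := hk
      rw [norm_mul, Real.norm_of_nonneg (show 0 ≤ α * k ^ (α - 1) by positivity)]
      exact mul_le_mul_of_nonneg_right (hb' _ (by positivity)) (by positivity)
  have h0 : Tendsto (fun k : ℝ => e (k ^ α)) atTop (𝓝 0) := by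
    refine squeeze_zero_norm' (a := fun k : ℝ => C / (δ + k ^ α)) ?_
      (Tendsto.div_atTop tendsto_const_nhds
        (tendsto_atTop_add_const_left _ _ (tendsto_rpow_atTop hα)))
    filter_upwards [eventually_ge_atTop 0] with k hk using hb _ (by positivity)
  obtain ⟨D, hD⟩ := exists_cos_integral_bound hEc hEd hi (B := C / δ) (fun k hk =>
    (hb _ (by positivity)).trans (div_le_div_of_nonneg_left hC hδ
      (le_add_of_nonneg_right (by positivity)))) h0
  have htr : ∀ y S : ℝ, 0 ≤ S → truncInvFourier (symbolG α α 1) y S =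
      ((Real.pi⁻¹ * ∫ k in (0 : ℝ)..S, e (k ^ α) * Real.cos (k * y) : ℝ) : ℂ) := by
    intro y S hS
    rw [truncInvFourier_of_even hcont (fun k => by simp [symbolG]), Complex.ofReal_mul,
      Complex.ofReal_inv, ← intervalIntegral.integral_ofReal]
    congr 1
    refine intervalIntegral.integral_congr fun k hk => ?_
    rw [uIcc_of_le hS] at hk
    rw [hE k hk.1, Complex.ofReal_mul]
  refine ⟨Real.pi⁻¹ * D, fun y hy => ⟨fun S hS => ?_, ?_⟩⟩
  · rw [htr y S hS, Complex.norm_real, norm_mul,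
      Real.norm_of_nonneg (inv_nonneg.2 Real.pi_pos.le), mul_div_assoc]
    exact mul_le_mul_of_nonneg_left ((hD y hy).1 S hS) (inv_nonneg.2 Real.pi_pos.le)
  · obtain ⟨l, hl⟩ := (hD y hy).2
    refine ⟨((Real.pi⁻¹ * l : ℝ) : ℂ), ?_⟩
    refine ((Complex.continuous_ofReal.tendsto _).comp (hl.const_mul Real.pi⁻¹)).congr' ?_
    filter_upwards [eventually_ge_atTop 0] with S hS using (htr y S hS).symm

theorem tendsto_invFourierAt {g : ℝ → ℂ} {x : ℝ} (h : InvFourierConvergesAt g x) :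
    Tendsto (truncInvFourier g x) atTop (𝓝 (invFourierAt g x)) :=
  tendsto_nhds_limUnder h

theorem truncInvFourier_comp_mul (g : ℝ → ℂ) (x R : ℝ) {ξ : ℝ} (hξ : 0 < ξ) :
    truncInvFourier (fun k => g (ξ * k)) x R = truncInvFourier g (x / ξ) (R * ξ) / ξ := by
  have hξ0 : (ξ : ℂ) ≠ 0 := by exact_mod_cast hξ.ne'
  have h := intervalIntegral.integral_comp_mul_left (a := -R) (b := R)
    (fun k : ℝ => Complex.exp (Complex.I * k * ((x / ξ : ℝ) : ℂ)) * g k) hξ.ne'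
  have e : ∫ k in (-R)..R, Complex.exp (Complex.I * k * x) * g (ξ * k) =
      ξ⁻¹ • ∫ k in (ξ * -R)..(ξ * R),
        Complex.exp (Complex.I * k * ((x / ξ : ℝ) : ℂ)) * g k := by
    rw [← h]
    refine intervalIntegral.integral_congr fun k _ => ?_
    congr 2
    push_cast
    field_simp
  rw [truncInvFourier, truncInvFourier, e, Complex.real_smul, Complex.ofReal_inv,
    show -(R * ξ) = ξ * -R by ring, mul_comm R]
  ring

/-- The pointwise form of the Mellin convolution of inverse Fourier transforms. -/
theorem mellin_convolution_pointwise {m : ℝ → ℂ} {g h : ℝ → ℂ} (hg : Continuous g)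
    (hm : IntegrableOn m (Ioi 0)) {C : ℝ} (hC : ∀ k, ‖g k‖ ≤ C)
    (hsub : ∀ k, h k = ∫ ξ in Ioi (0 : ℝ), m ξ * g (ξ * k)) {D : ℝ}
    (hD : ∀ y : ℝ, y ≠ 0 → (∀ S : ℝ, 0 ≤ S → ‖truncInvFourier g y S‖ ≤ D / |y|) ∧
      InvFourierConvergesAt g y) {x : ℝ} (hx : x ≠ 0) :
    InvFourierConvergesAt h x ∧
    IntegrableOn (fun ξ : ℝ => m ξ * invFourierAt g (x / ξ) / ξ) (Ioi 0) ∧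
    invFourierAt h x = ∫ ξ in Ioi (0 : ℝ), m ξ * invFourierAt g (x / ξ) / ξ := by
  set T : ℝ → ℝ → ℂ := fun R ξ => m ξ * truncInvFourier (fun k => g (ξ * k)) x R with hT
  have hTξ : ∀ R, ∀ ξ ∈ Ioi (0 : ℝ),
      T R ξ = m ξ * truncInvFourier g (x / ξ) (R * ξ) / ξ := fun R ξ hξ => by
    simp only [hT]
    rw [truncInvFourier_comp_mul g x R hξ, mul_div_assoc]
  -- On a bounded `k`-interval boundedness of `g` suffices for Fubini; the oscillation is needed
  -- only for `R → ∞`.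
  have hK : ∀ R : ℝ, Integrable (Function.uncurry fun (ξ k : ℝ) =>
      m ξ * (Complex.exp (Complex.I * k * x) * g (ξ * k)))
      ((volume.restrict (Ioi 0)).prod (volume.restrict (Ioc (-R) R))) := fun R => by
    have h1 : Integrable (fun p : ℝ × ℝ => m p.1)
        ((volume.restrict (Ioi 0)).prod (volume.restrict (Ioc (-R) R))) := by
      have : Integrable (fun _ : ℝ => (1 : ℂ)) (volume.restrict (Ioc (-R) R)) :=
        integrable_const 1
      simpa using hm.mul_prod this
    have h2 : Continuous fun p : ℝ × ℝ => Complex.exp (Complex.I * p.2 * x) * g (p.1 * p.2) := by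
      fun_prop
    refine h1.mul_bdd (c := C) h2.aestronglyMeasurable (Eventually.of_forall fun p => ?_)
    rw [norm_mul, show Complex.I * p.2 * x = ((p.2 * x : ℝ) : ℂ) * Complex.I by push_cast; ring,
      Complex.norm_exp_ofReal_mul_I, one_mul]
    exact hC _
  have hTeq : ∀ R, 0 ≤ R → ∀ ξ, T R ξ = (2 * Real.pi : ℂ)⁻¹ * ∫ k in Ioc (-R) R,
      m ξ * (Complex.exp (Complex.I * k * x) * g (ξ * k)) := fun R hR ξ => by
    simp only [hT, truncInvFourier]
    rw [intervalIntegral.integral_of_le (by linarith), integral_const_mul, mul_left_comm]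
  have hTi : ∀ R, 0 ≤ R → IntegrableOn (T R) (Ioi 0) := fun R hR =>
    ((hK R).integral_prod_left.const_mul (2 * Real.pi : ℂ)⁻¹).congr
      (Eventually.of_forall fun ξ => (hTeq R hR ξ).symm)
  have hTint : ∀ R, 0 ≤ R → truncInvFourier h x R = ∫ ξ in Ioi (0 : ℝ), T R ξ := fun R hR => by
    simp_rw [hTeq R hR]
    rw [integral_const_mul, integral_integral_swap (hK R), truncInvFourier,
      intervalIntegral.integral_of_le (by linarith)]
    congr 1
    refine integral_congr_ae (Eventually.of_forall fun k => ?_)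
    simp only
    rw [hsub, ← integral_const_mul]
    refine integral_congr_ae (Eventually.of_forall fun ξ => ?_)
    simp only
    ring
  -- The bound at `x/ξ` is `Dξ/|x|`, and the `1/ξ` from rescaling removes the `ξ`. The majorant is
  -- independent of `R` and integrable with `m`.
  have hbound : ∀ R, 0 ≤ R → ∀ ξ ∈ Ioi (0 : ℝ), ‖T R ξ‖ ≤ ‖m ξ‖ * (D / |x|) :=
    fun R hR ξ hξ => by
    have hξ' : 0 < ξ := hξ
    rw [hTξ R ξ hξ, mul_div_assoc, norm_mul, norm_div, Complex.norm_real,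
      Real.norm_of_nonneg hξ'.le]
    refine mul_le_mul_of_nonneg_left ?_ (norm_nonneg _)
    rw [div_le_iff₀ hξ']
    refine ((hD (x / ξ) (div_ne_zero hx hξ'.ne')).1 (R * ξ) (by positivity)).trans (le_of_eq ?_)
    rw [abs_div, abs_of_pos hξ']
    field_simp
  have hlim : ∀ ξ ∈ Ioi (0 : ℝ), Tendsto (fun R => T R ξ) atTop
      (𝓝 (m ξ * invFourierAt g (x / ξ) / ξ)) := fun ξ hξ => by
    have hξ' : 0 < ξ := hξ
    simp_rw [hTξ _ ξ hξ]
    exact (((tendsto_invFourierAt (hD (x / ξ) (div_ne_zero hx hξ'.ne')).2).comp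
      (tendsto_id.atTop_mul_const hξ')).const_mul (m ξ)).div_const _
  have hB : IntegrableOn (fun ξ => ‖m ξ‖ * (D / |x|)) (Ioi 0) := hm.norm.mul_const _
  have hmain : Tendsto (truncInvFourier h x) atTop
      (𝓝 (∫ ξ in Ioi (0 : ℝ), m ξ * invFourierAt g (x / ξ) / ξ)) := by
    refine (tendsto_integral_filter_of_dominated_convergence (μ := volume.restrict (Ioi 0))
      (F := T) (fun ξ => ‖m ξ‖ * (D / |x|)) ?_ ?_ hB ?_).congr' ?_
    · filter_upwards [eventually_ge_atTop 0] with R hR using (hTi R hR).aestronglyMeasurable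
    · filter_upwards [eventually_ge_atTop 0] with R hR
      filter_upwards [ae_restrict_mem measurableSet_Ioi] with ξ hξ using hbound R hR ξ hξ
    · filter_upwards [ae_restrict_mem measurableSet_Ioi] with ξ hξ using hlim ξ hξ
    · filter_upwards [eventually_ge_atTop 0] with R hR using (hTint R hR).symm
  refine ⟨⟨_, hmain⟩, ?_, hmain.limUnder_eq⟩
  refine hB.mono' ?_ ?_
  · refine aestronglyMeasurable_of_tendsto_ae (atTop : Filter ℕ) (f := fun n ξ => T n ξ)
      (fun n => (hTi n n.cast_nonneg).aestronglyMeasurable) ?_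
    filter_upwards [ae_restrict_mem measurableSet_Ioi] with ξ hξ
    exact (hlim ξ hξ).comp tendsto_natCast_atTop_atTop
  · filter_upwards [ae_restrict_mem measurableSet_Ioi] with ξ hξ
    refine le_of_tendsto (hlim ξ hξ).norm ?_
    filter_upwards [eventually_ge_atTop 0] with R hR using hbound R hR ξ hξ

end FracWave

end

theorem mainTheorem2 (α β γ : ℝ) (hα : 0 < α) (hβ : 0 < β) (hγ : γ = β / α) (hγ1 : γ < 1) :
    -- subordination identities
    (∀ κ : ℝ, 0 ≤ κ →
      (IntegrableOn (fun ξ : ℝ => FracWave.wrightM γ ξ *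
          FracWave.mittagLeffler α 1 (-(((κ * ξ) ^ α : ℝ) : ℂ))) (Ioi 0) ∧
        FracWave.mittagLeffler β 1 (-((κ ^ α : ℝ) : ℂ)) =
          ∫ ξ in Ioi (0 : ℝ), FracWave.wrightM γ ξ *
            FracWave.mittagLeffler α 1 (-(((κ * ξ) ^ α : ℝ) : ℂ))) ∧
      (IntegrableOn (fun ξ : ℝ => FracWave.wrightN γ ξ *
          FracWave.mittagLeffler α 1 (-(((κ * ξ) ^ α : ℝ) : ℂ))) (Ioi 0) ∧
        FracWave.mittagLeffler β 2 (-((κ ^ α : ℝ) : ℂ)) =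
          ∫ ξ in Ioi (0 : ℝ), FracWave.wrightN γ ξ *
            FracWave.mittagLeffler α 1 (-(((κ * ξ) ^ α : ℝ) : ℂ)))) ∧
    -- Mellin convolutions, in the sense of tempered distributions
    (α ≤ 2 →
      FracWave.BoundedSymbol (FracWave.symbolG α α 1) ∧
      FracWave.BoundedSymbol (FracWave.symbolG β α 1) ∧
      FracWave.BoundedSymbol (FracWave.symbolH β α 1) ∧
      FracWave.IsMellinConvolution (fun ξ => FracWave.wrightM γ ξ)
        (FracWave.distG α α 1) (FracWave.distG β α 1) ∧
      FracWave.IsMellinConvolution (fun ξ => FracWave.wrightN γ ξ)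
        (FracWave.distG α α 1) (FracWave.distH β α 1)) ∧
    -- Mellin convolutions, pointwise
    (α < 2 → ∀ x : ℝ, x ≠ 0 →
      FracWave.InvFourierConvergesAt (FracWave.symbolG α α 1) x ∧
      FracWave.InvFourierConvergesAt (FracWave.symbolG β α 1) x ∧
      FracWave.InvFourierConvergesAt (FracWave.symbolH β α 1) x ∧
      (IntegrableOn (fun ξ : ℝ => FracWave.wrightM γ ξ * FracWave.funG α α 1 (x / ξ) / ξ) (Ioi 0) ∧
        FracWave.funG β α 1 x =
          ∫ ξ in Ioi (0 : ℝ), FracWave.wrightM γ ξ * FracWave.funG α α 1 (x / ξ) / ξ) ∧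
      (IntegrableOn (fun ξ : ℝ => FracWave.wrightN γ ξ * FracWave.funG α α 1 (x / ξ) / ξ) (Ioi 0) ∧
        FracWave.funH β α 1 x =
          ∫ ξ in Ioi (0 : ℝ), FracWave.wrightN γ ξ * FracWave.funG α α 1 (x / ξ) / ξ)) := by
  open FracWave in
  have h0 : 0 < γ := hγ ▸ div_pos hβ hα
  have hγα : γ * α = β := by rw [hγ, div_mul_cancel₀ _ hα.ne']
  -- The choices `μ = 1 - γ` and `μ = 2 - γ` make the second Mittag-Leffler parameter `μ + γ` equal
  -- to `1` and `2`.
  have subM : ∀ κ : ℝ, 0 ≤ κ → _ := fun κ hκ => subordination hα hγα h0 hγ1 (1 - γ) hκ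
  have subN : ∀ κ : ℝ, 0 ≤ κ → _ := fun κ hκ => subordination hα hγα h0 hγ1 (2 - γ) hκ
  simp_rw [← wrightM_eq, sub_add_cancel] at subM
  simp_rw [← wrightN_eq, sub_add_cancel] at subN
  have intM : IntegrableOn (fun ξ : ℝ => wrightM γ ξ) (Ioi 0) := by
    simp_rw [wrightM_eq]
    exact integrableOn_wright h0 hγ1 _
  have intN : IntegrableOn (fun ξ : ℝ => wrightN γ ξ) (Ioi 0) := by
    simp_rw [wrightN_eq]
    exact integrableOn_wright h0 hγ1 _
  have habs : ∀ k ξ : ℝ, ξ ∈ Ioi (0 : ℝ) → (|k| * ξ) = |ξ * k| := fun k ξ hξ => by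
    rw [abs_mul, abs_of_pos (show 0 < ξ from hξ), mul_comm]
  have hsubG : ∀ k, symbolG β α 1 k =
      ∫ ξ in Ioi (0 : ℝ), wrightM γ ξ * symbolG α α 1 (ξ * k) := fun k => by
    rw [symbolG_one, (subM _ (abs_nonneg k)).2]
    refine setIntegral_congr_fun measurableSet_Ioi fun ξ hξ => ?_
    simp only [symbolG_one, habs k ξ hξ]
  have hsubH : ∀ k, symbolH β α 1 k =
      ∫ ξ in Ioi (0 : ℝ), wrightN γ ξ * symbolG α α 1 (ξ * k) := fun k => by
    rw [symbolH_one, (subN _ (abs_nonneg k)).2]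
    refine setIntegral_congr_fun measurableSet_Ioi fun ξ hξ => ?_
    simp only [symbolG_one, habs k ξ hξ]
  have hcG : ∀ b, 0 < b → Continuous (symbolG b α 1) := fun b hb =>
    (continuous_mittagLeffler_abs_rpow hb le_rfl hα).congr fun k => (symbolG_one b α k).symm
  have hcH : Continuous (symbolH β α 1) :=
    (continuous_mittagLeffler_abs_rpow hβ one_le_two hα).congr fun k => (symbolH_one β α k).symm
  have hbG : α ≤ 2 → ∃ C : ℝ, ∀ k, ‖symbolG α α 1 k‖ ≤ C := fun h => by
    obtain ⟨C, _, hC⟩ := exists_norm_mittagLeffler_one_le hα h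
    exact ⟨C, fun k => by rw [symbolG_one]; exact hC _ (by positivity)⟩
  refine ⟨fun κ hκ => ⟨subM κ hκ, subN κ hκ⟩, fun h2 => ?_, fun h2 x hx => ?_⟩
  · obtain ⟨C, hC⟩ := hbG h2
    obtain ⟨C₁, -, hC₁⟩ := exists_norm_mittagLeffler_le hα h2 hγα h0 hγ1 (1 - γ)
    obtain ⟨C₂, -, hC₂⟩ := exists_norm_mittagLeffler_le hα h2 hγα h0 hγ1 (2 - γ)
    rw [sub_add_cancel] at hC₁ hC₂
    have b1 : BoundedSymbol (symbolG β α 1) := boundedSymbol_of_continuous (hcG β hβ)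
      (C := C₁) fun k => by rw [symbolG_one]; exact hC₁ _ (abs_nonneg k)
    have b2 : BoundedSymbol (symbolH β α 1) := boundedSymbol_of_continuous hcH
      (C := C₂) fun k => by rw [symbolH_one]; exact hC₂ _ (abs_nonneg k)
    exact ⟨boundedSymbol_of_continuous (hcG α hα) hC, b1, b2,
      isMellinConvolution_invFourier (hcG α hα) intM hC b1 hsubG,
      isMellinConvolution_invFourier (hcG α hα) intN hC b2 hsubH⟩
  · obtain ⟨C, hC⟩ := hbG h2.le
    obtain ⟨D, hD⟩ := exists_truncInvFourier_bound hα h2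
    obtain ⟨m1, m2, m3⟩ := mellin_convolution_pointwise (hcG α hα) intM hC hsubG hD hx
    obtain ⟨n1, n2, n3⟩ := mellin_convolution_pointwise (hcG α hα) intN hC hsubH hD hx
    exact ⟨(hD x hx).2, m1, n1, ⟨m2, m3⟩, ⟨n2, n3⟩⟩
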